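/- Setting. Let $G$ be a nilpotent group generated by a $k$-tuple $S=(s_1,\dots,s_k)$. Formal commutators are the letters $s_i^{\pm1}$ and, inductively, the brackets $[c_1,c_2]$ of formal commutators; $\mathfrak C(S)$ is the set of all of them, and each has an image in $G$ through $[x,y]=x^{-1}y^{-1}xy$. A weight system $\mathfrak w$ consists of $w_i\in(0,\infty)\times\mathbb R^{d-1}$ ($1\le i\le k$, $d\ge1$), extended to $\mathfrak C(S)$ by $w(s_i^{\pm1})=w_i$ and $w([c_1,c_2])=w(c_1)+w(c_2)$; weights are compared lexicographically, and $\bar w_1<\bar w_2<\cdots$ are the values of $w$ on $\mathfrak C(S)$. Let $G^{\mathfrak w}_j$ be the subgroup of $G$ generated by the images of all $c$ with $w(c)\ge\bar w_j$; let $j_*$ be the smallest integer with $G^{\mathfrak w}_{j_*+1}=\{e\}$, and let $R^{\mathfrak w}_j$ be the torsion-free rank of the abelian group $G^{\mathfrak w}_j/G^{\mathfrak w}_{j+1}$. A weight-function system $\mathfrak F$ consists of non-decreasing functions $F_i:[1,\infty)\to[1,\infty)$, extended by $F_{s_i^{\pm1}}=F_i$ and $F_{[c_1,c_2]}=F_{c_1}F_{c_2}$.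 Assume (F1) there is $C\ge1$ with $2F_i(r)\le F_i(Cr)$ and $F_i(2r)\le CF_i(r)$ for all $i$ and all $r\ge1$; (F2) for all $c,c'\in\mathfrak C(S)$: $w(c)\le w(c')$ if and only if there is $C\ge1$ with $F_c(r)\le CF_{c'}(r)$ for all $r\ge1$. For a set or tuple $\Gamma$ of formal commutators whose images generate $G$, let $F_\Gamma=F_{c_0}$ where $c_0$ is any element of $\Gamma$ of minimal weight, and let $F_\Gamma^{-1}(y)=\inf\{r\ge1: F_\Gamma(r)\ge y\}$. Put $\|e\|_{\Gamma,\mathfrak F}=0$; for $g\ne e$, let $\|g\|_{\Gamma,\mathfrak F}$ be the infimum of the $\rho\ge1$ such that $g$ is the image of a finite word over $\Gamma\cup\Gamma^{-1}$ in which, for each $c\in\Gamma$, the number of occurrences of $c^{\pm1}$ is at most $F_c(F_\Gamma^{-1}(\rho))$. Let $$Q(\Gamma,\mathfrak F,r)=\{g\in G: F_\Gamma^{-1}(\|g\|_{\Gamma,\mathfrak F})\le r\}.$$ Let $\Sigma=(c_1,\dots,c_t)$ be a non-empty tuple of formal commutators with $w(c_1)\le\dots\le w(c_t)$ such that, for each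 $1\le j\le j_*$, the images of the $c_i$ with $w(c_i)=\bar w_j$ generate $G^{\mathfrak w}_j$ modulo $G^{\mathfrak w}_{j+1}$, and the first $R^{\mathfrak w}_j$ of these $c_i$ are free (linearly independent over $\mathbb Z$) in $G^{\mathfrak w}_j/G^{\mathfrak w}_{j+1}$. Write $f\simeq g$ on $[r_0,\infty)$ if there is $C\ge1$ with $C^{-1}g(r)\le f(r)\le Cg(r)$ for all $r\ge r_0$. Let $r_0\ge1$ and let $\mathbf F_j$ ($1\le j\le j_*$) be functions such that $\mathbf F_j\simeq F_c$ on $[r_0,\infty)$ for every formal commutator $c$ with $w(c)=\bar w_j$. Theorem. All the sets $Q(\mathfrak C(S),\mathfrak F,r)$, $Q(\Sigma,\mathfrak F,r)$ and $Q(S,\mathfrak F,r)$ with $r\ge1$ are finite, $$\#Q(\mathfrak C(S),\mathfrak F,r)\simeq\#Q(\Sigma,\mathfrak F,r)\simeq\#Q(S,\mathfrak F,r)\quad\text{on }[1,\infty),$$ $$\#Q(S,\mathfrak F,r)\simeq\prod_{j=1}^{j_*}\mathbf F_j(r)^{R^{\mathfrak w}_j}\quad\text{on }[r_0,\infty).$$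 Moreover, if $d=1$ and $\mathfrak w$ is generated by arbitrary $w_1,\dots,w_k\in(0,\infty)$ and $F_i(r)=r^{w_i}$, then on $[1,\infty)$ each of $\#Q(\mathfrak C(S),\mathfrak F,r)$, $\#Q(\Sigma,\mathfrak F,r)$ (for every $\Sigma$ as above) and $\#Q(S,\mathfrak F,r)$ is $\simeq r^{D(S,\mathfrak w)}$, where $D(S,\mathfrak w)=\sum_{j=1}^{j_*}\bar w_jR^{\mathfrak w}_j$. -/

import Mathlib

namespace WeightedVolume

/-- Formal commutators on the alphabet `s_1^{±1}, …, s_k^{±1}`: the letters `s_i` (`letter i true`)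
and `s_i^{-1}` (`letter i false`), and the formal brackets `[c₁, c₂]`. -/
inductive FormalComm (k : ℕ) : Type
  | letter (i : Fin k) (positive : Bool) : FormalComm k
  | bracket (c₁ c₂ : FormalComm k) : FormalComm k

/-- The image of a formal commutator in a group, with `[x, y] = x⁻¹ y⁻¹ x y`. -/
def FormalComm.eval {k : ℕ} {G : Type*} [Group G] (s : Fin k → G) : FormalComm k → G
  | .letter i true => s i
  | .letter i false => (s i)⁻¹
  | .bracket c₁ c₂ => (c₁.eval s)⁻¹ * (c₂.eval s)⁻¹ * c₁.eval s * c₂.eval s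

/-- The number of letters of a formal commutator. -/
def FormalComm.length {k : ℕ} : FormalComm k → ℕ
  | .letter _ _ => 1
  | .bracket c₁ c₂ => c₁.length + c₂.length

/-- A `(d+1)`-dimensional weight system: weights `w_i ∈ (0,∞) × ℝ^d`, where `ℝ^(d+1)` carries the
lexicographic order. -/
structure WeightSystem (k d : ℕ) where
  gen : Fin k → Lex (Fin (d + 1) → ℝ)
  pos : ∀ i, 0 < ofLex (gen i) 0

/-- The weight of a formal commutator. -/
def WeightSystem.weight {k d : ℕ} (w : WeightSystem k d) :
    FormalComm k → Lex (Fin (d + 1) → ℝ)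
  | .letter i _ => w.gen i
  | .bracket c₁ c₂ => w.weight c₁ + w.weight c₂

open Classical in
/-- The least element of a set, when there is one. -/
noncomputable def leastElt {α : Type*} [Preorder α] [Zero α] (A : Set α) : α :=
  if h : ∃ a, IsLeast A a then h.choose else 0

/-- The increasing enumeration of the values of the weight system, starting at index `0`:
`w.level j` is the `(j+1)`-st smallest weight value. -/
noncomputable def WeightSystem.level {k d : ℕ} (w : WeightSystem k d) :
    ℕ → Lex (Fin (d + 1) → ℝ)
  | 0 => leastElt (Set.range w.weight)
  | j + 1 => leastElt {v | v ∈ Set.range w.weight ∧ w.level j < v}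

section Helpers

variable {k d : ℕ} (w : WeightSystem k d)

theorem weight_pos (c : FormalComm k) : 0 < ofLex (w.weight c) 0 := by
  induction c with
  | letter i b => exact w.pos i
  | bracket c₁ c₂ h₁ h₂ => exact add_pos h₁ h₂

theorem lex_pos {v : Lex (Fin (d + 1) → ℝ)} (h : 0 < ofLex v 0) : 0 < v := by
  refine ⟨0, fun j hj => absurd hj (Fin.not_lt_zero j), h⟩

theorem lex_coord_le {u v : Lex (Fin (d + 1) → ℝ)} (h : u ≤ v) : ofLex u 0 ≤ ofLex v 0 := by
  by_contra hlt
  push Not at hlt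
  have : v < u := ⟨0, fun j hj => absurd hj (Fin.not_lt_zero j), hlt⟩
  exact absurd h (not_le.mpr this)

theorem weight_lt_bracket (c₁ c₂ : FormalComm k) :
    w.weight c₁ < w.weight (.bracket c₁ c₂) :=
  lt_add_of_pos_right _ (lex_pos (weight_pos w c₂))

theorem finite_length_le (n : ℕ) : {c : FormalComm k | c.length ≤ n}.Finite := by
  induction n with
  | zero =>
    refine Set.Finite.subset Set.finite_empty ?_
    intro c hc
    have : ∀ c : FormalComm k, 0 < c.length := by
      intro c
      induction c with
      | letter i b => simp [FormalComm.length]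
      | bracket c₁ c₂ h₁ h₂ => simp only [FormalComm.length]; omega
    have h := this c
    simp only [Set.mem_ofPred_eq] at hc
    omega
  | succ n ih =>
    refine Set.Finite.subset ((Set.finite_range
      (fun p : Fin k × Bool => FormalComm.letter p.1 p.2)).union
      (Set.Finite.image2 FormalComm.bracket ih ih)) ?_
    intro c hc
    have hp : ∀ c : FormalComm k, 0 < c.length := by
      intro c
      induction c with
      | letter i b => simp [FormalComm.length]
      | bracket c₁ c₂ h₁ h₂ => simp only [FormalComm.length]; omega
    cases c with
    | letter i b => exact Or.inl ⟨(i, b), rfl⟩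
    | bracket c₁ c₂ =>
      right
      have h₁ := hp c₁
      have h₂ := hp c₂
      simp only [Set.mem_ofPred_eq, FormalComm.length] at hc
      exact ⟨c₁, by simp only [Set.mem_ofPred_eq]; omega, c₂,
        by simp only [Set.mem_ofPred_eq]; omega, rfl⟩

theorem finite_weight_le (v : Lex (Fin (d + 1) → ℝ)) : {c | w.weight c ≤ v}.Finite := by
  obtain ⟨ε, hε, hle⟩ : ∃ ε > 0, ∀ i, ε ≤ ofLex (w.gen i) 0 := by
    rcases isEmpty_or_nonempty (Fin k) with h | h
    · exact ⟨1, one_pos, fun i => (IsEmpty.false i).elim⟩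
    · obtain ⟨i, hi⟩ := Finite.exists_min (fun i => ofLex (w.gen i) 0)
      exact ⟨_, w.pos i, hi⟩
  have hlen : ∀ c : FormalComm k, (c.length : ℝ) * ε ≤ ofLex (w.weight c) 0 := by
    intro c
    induction c with
    | letter i b => simpa [FormalComm.length, WeightSystem.weight] using hle i
    | bracket c₁ c₂ h₁ h₂ =>
      have : ofLex (w.weight (.bracket c₁ c₂)) 0
          = ofLex (w.weight c₁) 0 + ofLex (w.weight c₂) 0 := rfl
      rw [this, FormalComm.length]
      push_cast
      linarith
  obtain ⟨n, hn⟩ := exists_nat_ge (ofLex v 0 / ε)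
  refine (finite_length_le n).subset ?_
  intro c hc
  have h1 := (hlen c).trans (lex_coord_le hc)
  have h2 : (c.length : ℝ) ≤ n := ((le_div_iff₀ hε).mpr h1).trans hn
  exact_mod_cast h2

theorem isLeast_leastElt {A : Set (Lex (Fin (d + 1) → ℝ))}
    (hA : A ⊆ Set.range w.weight) (hne : A.Nonempty) : IsLeast A (leastElt A) := by
  have hex : ∃ a, IsLeast A a := by
    obtain ⟨a, ha⟩ := hne
    have hfin : (A ∩ Set.Iic a).Finite := by
      refine ((finite_weight_le w a).image w.weight).subset ?_
      rintro u ⟨hu, hua⟩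
      obtain ⟨c, rfl⟩ := hA hu
      exact ⟨c, hua, rfl⟩
    obtain ⟨m, hm, hmin⟩ := Set.exists_min_image _ id hfin ⟨a, ha, le_refl a⟩
    refine ⟨m, hm.1, fun u hu => ?_⟩
    rcases le_total u a with h | h
    · exact hmin u ⟨hu, h⟩
    · exact hm.2.trans h
  unfold leastElt
  rw [dif_pos hex]
  exact hex.choose_spec

theorem isLeast_level_zero [NeZero k] : IsLeast (Set.range w.weight) (w.level 0) :=
  isLeast_leastElt w subset_rfl ⟨_, .letter 0 true, rfl⟩

theorem isLeast_level_succ (j : ℕ) (hne : ∃ c, w.level j < w.weight c) :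
    IsLeast {v | v ∈ Set.range w.weight ∧ w.level j < v} (w.level (j + 1)) :=
  isLeast_leastElt w (fun _ h => h.1) (hne.elim fun c hc => ⟨_, ⟨c, rfl⟩, hc⟩)

theorem level_mem [NeZero k] (j : ℕ) : w.level j ∈ Set.range w.weight := by
  induction j with
  | zero => exact (isLeast_level_zero w).1
  | succ j ih =>
    obtain ⟨c, hc⟩ := ih
    exact (isLeast_level_succ w j
      ⟨.bracket c c, hc ▸ weight_lt_bracket w c c⟩).1.1

theorem level_lt_succ [NeZero k] (j : ℕ) : w.level j < w.level (j + 1) := by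
  obtain ⟨c, hc⟩ := level_mem w j
  exact (isLeast_level_succ w j ⟨.bracket c c, hc ▸ weight_lt_bracket w c c⟩).1.2

/-- `w.level` is strictly increasing … -/
theorem strictMono_level [NeZero k] : StrictMono w.level :=
  strictMono_nat_of_lt_succ (level_lt_succ w)

/-- … and takes exactly the values of the weight system. -/
theorem range_level [NeZero k] : Set.range w.level = Set.range w.weight := by
  refine Set.Subset.antisymm (Set.range_subset_iff.mpr (level_mem w)) ?_
  rintro _ ⟨c, rfl⟩
  by_contra hnot
  have hlt : ∀ j, w.level j < w.weight c := by
    intro j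
    induction j with
    | zero =>
      exact lt_of_le_of_ne ((isLeast_level_zero w).2 ⟨c, rfl⟩) fun h => hnot ⟨0, h⟩
    | succ j ih =>
      exact lt_of_le_of_ne ((isLeast_level_succ w j ⟨c, ih⟩).2 ⟨⟨c, rfl⟩, ih⟩)
        fun h => hnot ⟨j + 1, h⟩
  have hfin : (Set.range w.level).Finite := by
    refine ((finite_weight_le w (w.weight c)).image w.weight).subset ?_
    rintro _ ⟨j, rfl⟩
    obtain ⟨c', hc'⟩ := level_mem w j
    exact ⟨c', by simpa [hc'] using (hlt j).le, hc'⟩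
  exact Set.infinite_range_of_injective (strictMono_level w).injective hfin

end Helpers

/-- The subgroup generated by the images of all formal commutators of weight at least `w.level j`;
with indices starting at `0`, this is the `(j+1)`-st term of the filtration. -/
def filtration {k d : ℕ} {G : Type*} [Group G] (s : Fin k → G) (w : WeightSystem k d) (j : ℕ) :
    Subgroup G :=
  Subgroup.closure (FormalComm.eval s '' {c | w.level j ≤ w.weight c})

section Graded

variable {k d : ℕ} {G : Type*} [Group G] (s : Fin k → G) (w : WeightSystem k d)

theorem eval_mem_filtration {c : FormalComm k} {j : ℕ} (h : w.level j ≤ w.weight c) :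
    c.eval s ∈ filtration s w j :=
  Subgroup.subset_closure ⟨c, h, rfl⟩

theorem eval_mem_closure (c : FormalComm k) : c.eval s ∈ Subgroup.closure (Set.range s) := by
  induction c with
  | letter i b =>
    have h : s i ∈ Subgroup.closure (Set.range s) := Subgroup.subset_closure ⟨i, rfl⟩
    cases b
    · exact inv_mem h
    · exact h
  | bracket c₁ c₂ h₁ h₂ => exact mul_mem (mul_mem (mul_mem (inv_mem h₁) (inv_mem h₂)) h₁) h₂

theorem filtration_le_closure (j : ℕ) : filtration s w j ≤ Subgroup.closure (Set.range s) := by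
  refine (Subgroup.closure_le _).mpr ?_
  rintro _ ⟨c, -, rfl⟩
  exact eval_mem_closure s c

theorem letter_conj_mem {j : ℕ} (i : Fin k) (b : Bool) {x : G} (hx : x ∈ filtration s w j) :
    ((FormalComm.letter i b).eval s)⁻¹ * x * (FormalComm.letter i b).eval s
      ∈ filtration s w j := by
  set u := (FormalComm.letter i b).eval s with hu
  have hle : filtration s w j ≤ (filtration s w j).comap (MulAut.conj u⁻¹).toMonoidHom := by
    refine (Subgroup.closure_le _).mpr ?_
    rintro _ ⟨c, hc, rfl⟩
    have h1 := eval_mem_filtration s w (j := j) hc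
    have h2 : (FormalComm.bracket c (.letter i b)).eval s ∈ filtration s w j :=
      eval_mem_filtration s w (le_trans hc (weight_lt_bracket w _ _).le)
    have h3 := mul_mem h1 h2
    simp only [FormalComm.eval, ← hu] at h3
    simp only [Subgroup.coe_comap, Set.mem_preimage, SetLike.mem_coe, MulEquiv.coe_toMonoidHom,
      MulAut.conj_apply, inv_inv]
    convert h3 using 1
    group
  simpa using hle hx

theorem conj_mem_filtration {j : ℕ} {g x : G} (hg : g ∈ Subgroup.closure (Set.range s))
    (hx : x ∈ filtration s w j) : g * x * g⁻¹ ∈ filtration s w j := by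
  suffices H : ∀ y ∈ filtration s w j, g * y * g⁻¹ ∈ filtration s w j ∧
      g⁻¹ * y * g ∈ filtration s w j from (H x hx).1
  induction hg using Subgroup.closure_induction with
  | mem g hg =>
    obtain ⟨i, rfl⟩ := hg
    intro y hy
    exact ⟨by simpa [FormalComm.eval] using letter_conj_mem s w i false hy,
      by simpa [FormalComm.eval] using letter_conj_mem s w i true hy⟩
  | one => intro y hy; simpa using hy
  | mul a b _ _ ha hb =>
    intro y hy
    refine ⟨?_, ?_⟩
    · have := (ha _ (hb y hy).1).1
      simpa [mul_assoc] using this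
    · have := (hb _ (ha y hy).2).2
      simpa [mul_assoc] using this
  | inv a _ ha => intro y hy; simpa using (ha y hy).symm

instance filtration_subgroupOf_normal (j : ℕ) :
    ((filtration s w (j + 1)).subgroupOf (filtration s w j)).Normal := by
  refine ⟨fun n hn g => ?_⟩
  rw [Subgroup.mem_subgroupOf] at hn ⊢
  exact conj_mem_filtration s w (filtration_le_closure s w j g.2) hn

/-- The quotient of two consecutive terms of the filtration. -/
abbrev Graded (j : ℕ) : Type _ :=
  filtration s w j ⧸ (filtration s w (j + 1)).subgroupOf (filtration s w j)

theorem comm_mem {j : ℕ} {g x : G} (hg : g ∈ Subgroup.closure (Set.range s))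
    (hx : x ∈ filtration s w j) : x⁻¹ * g⁻¹ * x * g ∈ filtration s w (j + 1) := by
  have hbase : ∀ i : Fin k, ∀ x ∈ filtration s w j,
      x⁻¹ * (s i)⁻¹ * x * s i ∈ filtration s w (j + 1) := by
    intro i x hx
    induction hx using Subgroup.closure_induction with
    | mem x hx =>
      obtain ⟨c, hc, rfl⟩ := hx
      have hlt : w.level j < w.weight (.bracket c (.letter i true)) :=
        lt_of_le_of_lt hc (weight_lt_bracket w _ _)
      exact eval_mem_filtration s w (c := .bracket c (.letter i true))
        ((isLeast_level_succ w j ⟨_, hlt⟩).2 ⟨⟨_, rfl⟩, hlt⟩)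
    | one => simp
    | mul a b hac hbc ha hb =>
      have hb' := filtration_le_closure s w j hbc
      have h1 := conj_mem_filtration s w (inv_mem hb') ha
      convert mul_mem h1 hb using 1
      group
    | inv a hac ha =>
      have ha' := filtration_le_closure s w j hac
      have h1 := conj_mem_filtration s w ha' (inv_mem ha)
      convert h1 using 1
      group
  induction hg using Subgroup.closure_induction with
  | mem g hg => obtain ⟨i, rfl⟩ := hg; exact hbase i x hx
  | one => simp
  | mul a b hac hbc ha hb =>
    have h1 := conj_mem_filtration s w (inv_mem hbc) ha
    convert mul_mem hb h1 using 1
    group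
  | inv a hac ha =>
    have h1 := conj_mem_filtration s w hac (inv_mem ha)
    convert h1 using 1
    group

instance gradedCommGroup (j : ℕ) : CommGroup (Graded s w j) :=
  { (inferInstance : Group (Graded s w j)) with
    mul_comm := by
      intro a b
      induction a using QuotientGroup.induction_on with
      | H x =>
      induction b using QuotientGroup.induction_on with
      | H y =>
      rw [← QuotientGroup.mk_mul, ← QuotientGroup.mk_mul, eq_comm, QuotientGroup.eq,
        Subgroup.mem_subgroupOf]
      have := comm_mem s w (filtration_le_closure s w j y.2) x.2
      simpa [mul_assoc] using this }

end Graded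

/-- The torsion free rank of the `j`-th quotient of the filtration. -/
noncomputable def gradedRank {k d : ℕ} {G : Type*} [Group G] (s : Fin k → G)
    (w : WeightSystem k d) (j : ℕ) : ℕ :=
  Module.finrank ℤ (Additive (Graded s w j))

/-- The number of steps of the filtration: the smallest `j` such that `filtration s w j` is trivial
(indices start at `0`, so the nontrivial terms are those of index `0, …, numSteps - 1`). -/
noncomputable def numSteps {k d : ℕ} {G : Type*} [Group G] (s : Fin k → G)
    (w : WeightSystem k d) : ℕ :=
  sInf {j | filtration s w j = ⊥}

/-- The homogeneous dimension, the sum of the ranks times the weight values (meant for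
one-dimensional weights, i.e. `d = 0`). -/
noncomputable def homDim {k : ℕ} {G : Type*} [Group G] (s : Fin k → G)
    (w : WeightSystem k 0) : ℝ :=
  ∑ j ∈ Finset.range (numSteps s w), ofLex (w.level j) 0 * gradedRank s w j

/-- Increasing functions `F_i : [1,∞) → [1,∞)`. Values outside `[1,∞)` are irrelevant. -/
structure WeightFunctions (k : ℕ) where
  gen : Fin k → ℝ → ℝ
  mono : ∀ i, MonotoneOn (gen i) (Set.Ici 1)
  one_le : ∀ i r, 1 ≤ r → 1 ≤ gen i r

/-- The functions `F_c`, with `F_{[c₁,c₂]} = F_{c₁} F_{c₂}`. -/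
def WeightFunctions.fn {k : ℕ} (F : WeightFunctions k) : FormalComm k → ℝ → ℝ
  | .letter i _ => F.gen i
  | .bracket c₁ c₂ => fun r => F.fn c₁ r * F.fn c₂ r

/-- The growth condition on the generating weight functions. -/
def WeightFunctions.Doubling {k : ℕ} (F : WeightFunctions k) : Prop :=
  ∃ C : ℝ, 1 ≤ C ∧ ∀ i, ∀ r : ℝ, 1 ≤ r →
    2 * F.gen i r ≤ F.gen i (C * r) ∧ F.gen i (2 * r) ≤ C * F.gen i r

/-- Compatibility of a weight system and a weight-function system. -/
def Compatible {k d : ℕ} (w : WeightSystem k d) (F : WeightFunctions k) : Prop :=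
  ∀ c c' : FormalComm k, w.weight c ≤ w.weight c' ↔
    ∃ C : ℝ, 1 ≤ C ∧ ∀ r : ℝ, 1 ≤ r → F.fn c r ≤ C * F.fn c' r

/-- The (generalized) inverse of an increasing unbounded function on `[1,∞)`. -/
noncomputable def genInv (f : ℝ → ℝ) (y : ℝ) : ℝ := sInf {r | 1 ≤ r ∧ y ≤ f r}

/-- The image in the group of a finite word in formal commutators and their inverses; `(c, true)`
stands for `c` and `(c, false)` for `c⁻¹`. -/
def wordValue {k : ℕ} {G : Type*} [Group G] (s : Fin k → G)
    (ω : List (FormalComm k × Bool)) : G :=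
  (ω.map fun l => if l.2 then l.1.eval s else (l.1.eval s)⁻¹).prod

open Classical in
/-- The number of occurrences of `c^{±1}` in a word. -/
noncomputable def wordDeg {k : ℕ} (c : FormalComm k) (ω : List (FormalComm k × Bool)) : ℕ :=
  ω.countP fun l => l.1 = c

/-- `c₀` has minimal weight among the elements of `Γ`. -/
def IsMinWeight {k d : ℕ} (w : WeightSystem k d) (Γ : Set (FormalComm k)) (c₀ : FormalComm k) :
    Prop :=
  c₀ ∈ Γ ∧ ∀ c ∈ Γ, w.weight c₀ ≤ w.weight c

open Classical in
/-- The quasi-norm associated with a set `Γ` of formal commutators. The commutator `c₀` is an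
element of `Γ` of minimal weight, so that `F.fn c₀` is the function `F_Γ`. -/
noncomputable def quasiNorm {k : ℕ} {G : Type*} [Group G] (s : Fin k → G) (F : WeightFunctions k)
    (Γ : Set (FormalComm k)) (c₀ : FormalComm k) (g : G) : ℝ :=
  if g = 1 then 0 else
    sInf {ρ : ℝ | 1 ≤ ρ ∧ ∃ ω : List (FormalComm k × Bool), (∀ l ∈ ω, l.1 ∈ Γ) ∧
      wordValue s ω = g ∧ ∀ c ∈ Γ, (wordDeg c ω : ℝ) ≤ F.fn c (genInv (F.fn c₀) ρ)}

/-- The weighted ball of radius `r`. -/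
def ball {k : ℕ} {G : Type*} [Group G] (s : Fin k → G) (F : WeightFunctions k)
    (Γ : Set (FormalComm k)) (c₀ : FormalComm k) (r : ℝ) : Set G :=
  {g | genInv (F.fn c₀) (quasiNorm s F Γ c₀ g) ≤ r}

/-- The letters `s_1, …, s_k`. -/
def letters (k : ℕ) : Set (FormalComm k) := Set.range fun i => FormalComm.letter i true

/-- The number of entries of the tuple `c` of weight less than `w.level j`: the entries of weight
`w.level j` of a tuple ordered by weight start right after them. -/
noncomputable def blockStart {k d t : ℕ} (w : WeightSystem k d) (c : Fin t → FormalComm k)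
    (j : ℕ) : ℕ :=
  {i | w.weight (c i) < w.level j}.ncard

/-- A tuple of formal commutators with non-decreasing weights such that, for each step `j` of the
filtration, the entries of weight `w.level j` generate the `j`-th term modulo the next one, and the
first `gradedRank s w j` of these entries are free in the quotient. -/
structure IsAdapted {k d t : ℕ} {G : Type*} [Group G] (s : Fin k → G) (w : WeightSystem k d)
    (c : Fin t → FormalComm k) : Prop where
  mono : Monotone fun i => w.weight (c i)
  generates : ∀ j < numSteps s w,
    Subgroup.closure ((fun i => (c i).eval s) '' {i | w.weight (c i) = w.level j}) ⊔
      filtration s w (j + 1) = filtration s w j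
  free : ∀ j < numSteps s w, LinearIndependent ℤ
    fun i : {i : Fin t // w.weight (c i) = w.level j ∧
        (i : ℕ) < blockStart w c j + gradedRank s w j} =>
      Additive.ofMul (QuotientGroup.mk ⟨(c i.1).eval s,
        eval_mem_filtration s w i.2.1.ge⟩ : Graded s w j)

/-- Two-sided comparison up to a multiplicative constant on `[r₀,∞)`. -/
def ComparableFrom (r₀ : ℝ) (f g : ℝ → ℝ) : Prop :=
  ∃ C : ℝ, 1 ≤ C ∧ ∀ r : ℝ, r₀ ≤ r → C⁻¹ * g r ≤ f r ∧ f r ≤ C * g r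

/-- The one-dimensional weight system generated by positive reals `p_i`. -/
def powerWeights {k : ℕ} (p : Fin k → ℝ) (hp : ∀ i, 0 < p i) : WeightSystem k 0 where
  gen i := toLex fun _ => p i
  pos := hp

/-- The power functions `F_i(r) = r^{p_i}`. -/
noncomputable def powerFunctions {k : ℕ} (p : Fin k → ℝ) (hp : ∀ i, 0 < p i) :
    WeightFunctions k where
  gen i r := r ^ p i
  mono i _ ha _ _ hab := Real.rpow_le_rpow (zero_le_one.trans ha) hab (hp i).le
  one_le i _ hr := Real.one_le_rpow hr (hp i).le

end WeightedVolume

open WeightedVolume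

/-! All three ball counts are compared with one product, in which each layer of the filtration
contributes its weight function raised to the torsion-free rank of the layer.

Upper bound. Give the letter `c` the cost `1 / F_c(r)`. Since `F_[z,x] = F_z F_x`, moving `x` to the
left across a word multiplies the cost of that word by `1 + 1 / F_x(r) ≤ exp (1 / F_x(r))`, all
brackets created included. Hence collecting any family of letters turns cost `K` into at most `K exp
K`, uniformly in `r` (`exists_pull`). In a given layer, choose commutators whose classes are
independent with torsion cokernel. Collecting one of them together with its inverse leaves
`O(F_c(r))` possible exponents (`VolumeLE.mul_fn`). Any other commutator of that weight has a
positive power expressible by the chosen ones and heavier letters, so it costs only a constant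
factor (`VolumeLE.of_pow`). Nilpotency ends the descent, and it also leaves only finitely many
commutators with non-trivial image, so that the words defining a ball have bounded cost even over
the infinite alphabet (`wordBall_subset_costBall`).

Lower bound. It suffices that each power `c ^ n` with `n ≤ F_c(r)` agrees, modulo heavier
commutators, with a short word over the alphabet (`Approximable`). For the alphabet `S` this follows
by induction on `c`, because brackets are bilinear modulo heavier terms (`approximable_letters`).
Products of such approximations, with exponents in a box, have distinct classes by independence;
multiplying them by short elements of the next term of the filtration gives the product layer by
layer (`manyShort_step`).

The infima in the quasi-norm and in the inverse function only change radii by bounded factors, which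
doubling absorbs. `ball_volume` combines both bounds. -/

namespace WeightedVolume

/-! ### Words, their cost at a given scale, and collection. -/

section Words

variable {k d : ℕ} {G : Type*} [Group G] (s : Fin k → G) (w : WeightSystem k d)
  (F : WeightFunctions k)

/-- The formal inverse of a formal commutator. -/
def FormalComm.inv {k : ℕ} : FormalComm k → FormalComm k
  | .letter i b => .letter i !b
  | .bracket c₁ c₂ => .bracket c₂ c₁

theorem FormalComm.eval_inv (c : FormalComm k) : c.inv.eval s = (c.eval s)⁻¹ := by
  cases c with
  | letter i b => cases b <;> simp [FormalComm.inv, FormalComm.eval]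
  | bracket c₁ c₂ => simp [FormalComm.inv, FormalComm.eval, mul_assoc]

theorem FormalComm.weight_inv (c : FormalComm k) : w.weight c.inv = w.weight c := by
  cases c with
  | letter i b => rfl
  | bracket c₁ c₂ => exact add_comm _ _

theorem FormalComm.fn_inv (c : FormalComm k) : F.fn c.inv = F.fn c := by
  cases c with
  | letter i b => rfl
  | bracket c₁ c₂ => funext r; exact mul_comm _ _

theorem weight_lt_bracket_right (c₁ c₂ : FormalComm k) :
    w.weight c₂ < w.weight (.bracket c₁ c₂) :=
  lt_add_of_pos_left _ (lex_pos (weight_pos w c₁))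

theorem WeightFunctions.one_le_fn (c : FormalComm k) {r : ℝ} (hr : 1 ≤ r) : 1 ≤ F.fn c r := by
  induction c with
  | letter i b => exact F.one_le i r hr
  | bracket c₁ c₂ h₁ h₂ => exact one_le_mul_of_one_le_of_one_le h₁ h₂

theorem WeightFunctions.fn_pos (c : FormalComm k) {r : ℝ} (hr : 1 ≤ r) : 0 < F.fn c r :=
  one_pos.trans_le (F.one_le_fn c hr)

theorem WeightFunctions.fn_mono (c : FormalComm k) : MonotoneOn (F.fn c) (Set.Ici 1) := by
  induction c with
  | letter i b => exact F.mono i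
  | bracket c₁ c₂ h₁ h₂ =>
    intro a ha b hb hab
    exact mul_le_mul (h₁ ha hb hab) (h₂ ha hb hab) (F.fn_pos c₂ ha).le (F.fn_pos c₁ hb).le

/-- The image in the group of a word in formal commutators. -/
def listValue (ω : List (FormalComm k)) : G := (ω.map fun c => c.eval s).prod

/-- The cost at scale `r` of a word in formal commutators. -/
noncomputable def cost (r : ℝ) (ω : List (FormalComm k)) : ℝ := (ω.map fun c => (F.fn c r)⁻¹).sum

@[simp] theorem listValue_nil : listValue s [] = 1 := rfl
@[simp] theorem listValue_cons (c : FormalComm k) (ω : List (FormalComm k)) :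
    listValue s (c :: ω) = c.eval s * listValue s ω := by simp [listValue]
@[simp] theorem listValue_append (ω ω' : List (FormalComm k)) :
    listValue s (ω ++ ω') = listValue s ω * listValue s ω' := by simp [listValue]
@[simp] theorem cost_nil (r : ℝ) : cost F r [] = 0 := rfl
@[simp] theorem cost_cons (r : ℝ) (c : FormalComm k) (ω : List (FormalComm k)) :
    cost F r (c :: ω) = (F.fn c r)⁻¹ + cost F r ω := by simp [cost]
@[simp] theorem cost_append (r : ℝ) (ω ω' : List (FormalComm k)) :
    cost F r (ω ++ ω') = cost F r ω + cost F r ω' := by simp [cost]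

theorem cost_nonneg {r : ℝ} (hr : 1 ≤ r) (ω : List (FormalComm k)) : 0 ≤ cost F r ω := by
  induction ω with
  | nil => simp
  | cons c ω ih => rw [cost_cons]; exact add_nonneg (inv_nonneg.mpr (F.fn_pos c hr).le) ih

theorem cost_filter_add (r : ℝ) (p : FormalComm k → Prop) [DecidablePred p]
    (ω : List (FormalComm k)) :
    cost F r (ω.filter fun c => p c) + cost F r (ω.filter fun c => ¬ p c) = cost F r ω := by
  induction ω with
  | nil => simp
  | cons c ω ih =>
    by_cases h : p c
    · simp only [h, decide_true, List.filter_cons_of_pos, cost_cons, not_true_eq_false,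
        decide_false, Bool.false_eq_true, not_false_eq_true, List.filter_cons_of_neg, ← ih]
      ring
    · simp only [h, decide_true, List.filter_cons_of_pos, cost_cons, not_false_eq_true,
        decide_false, Bool.false_eq_true, List.filter_cons_of_neg, ← ih]
      ring

theorem cost_eq_length_mul (r : ℝ) (f : ℝ) (ω : List (FormalComm k))
    (h : ∀ c ∈ ω, F.fn c r = f) : cost F r ω = ω.length * f⁻¹ := by
  induction ω with
  | nil => simp
  | cons c ω ih =>
    rw [cost_cons, ih fun c' hc' => h c' (List.mem_cons_of_mem _ hc'), h c List.mem_cons_self,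
      List.length_cons]
    push_cast
    ring

/-- This is `z x = x z [z, x]`, applied to each letter that `x` crosses. The new brackets stay to
the right of `x`, so they are never crossed by the same `x`. -/
theorem listValue_pass (x : FormalComm k) (ω : List (FormalComm k)) :
    listValue s ω * x.eval s =
      x.eval s * listValue s (ω.flatMap fun z => [z, .bracket z x]) := by
  induction ω with
  | nil => simp
  | cons z ω ih =>
    rw [listValue_cons, mul_assoc, ih, List.flatMap_cons, listValue_append]
    simp only [listValue_cons, listValue_nil, FormalComm.eval]
    group

/-- Multiplicativity of the weight functions makes the cost of `[z, x]` the product of the costs of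
`z` and `x`. -/
theorem cost_pass (r : ℝ) (x : FormalComm k) (ω : List (FormalComm k)) :
    cost F r (ω.flatMap fun z => [z, .bracket z x]) = cost F r ω * (1 + (F.fn x r)⁻¹) := by
  induction ω with
  | nil => simp
  | cons z ω ih =>
    rw [List.flatMap_cons, cost_append, ih]
    simp only [cost_cons, cost_nil, WeightFunctions.fn, mul_inv]
    ring

/-- The word is read from left to right. A letter satisfying `p` crosses only the remainder `ω'`,
whose cost grows by a factor at most the exponential of the cost of that letter; these exponentials
multiply to the exponential of the total cost pulled out. The brackets created are left in the
remainder. -/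
theorem exists_pull_aux (p : FormalComm k → Prop) [DecidablePred p]
    (v : Lex (Fin (d + 1) → ℝ)) (hp : ∀ c, p c → v ≤ w.weight c) {r : ℝ} (hr : 1 ≤ r)
    (ω : List (FormalComm k)) :
    ∃ ω' : List (FormalComm k),
      listValue s ω = listValue s (ω.filter fun c => p c) * listValue s ω' ∧
      (∀ c ∈ ω', (c ∈ ω ∧ ¬ p c) ∨ v < w.weight c) ∧
      cost F r ω' ≤ cost F r (ω.filter fun c => ¬ p c) *
        Real.exp (cost F r (ω.filter fun c => p c)) := by
  induction ω using List.reverseRecOn with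
  | nil => exact ⟨[], by simp⟩
  | append_singleton ω x ih =>
    obtain ⟨ω', h1, h2, h3⟩ := ih
    by_cases hx : p x
    · refine ⟨ω'.flatMap fun z => [z, .bracket z x], ?_, ?_, ?_⟩
      · rw [listValue_append, h1, List.filter_append, listValue_append, mul_assoc]
        simp only [listValue_cons, listValue_nil, mul_one, hx, decide_true,
          List.filter_cons_of_pos, List.filter_nil]
        rw [listValue_pass, mul_assoc]
      · intro c hc
        obtain ⟨z, hz, hc⟩ := List.mem_flatMap.mp hc
        simp only [List.mem_cons, List.not_mem_nil, or_false] at hc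
        rcases hc with rfl | rfl
        · rcases h2 c hz with h | h
          · exact Or.inl ⟨List.mem_append_left _ h.1, h.2⟩
          · exact Or.inr h
        · exact Or.inr ((hp x hx).trans_lt (weight_lt_bracket_right w z x))
      · rw [cost_pass]
        simp only [List.filter_append, cost_append, hx, decide_true, List.filter_cons_of_pos,
          List.filter_nil, cost_cons, cost_nil, add_zero, not_true_eq_false, decide_false,
          Bool.false_eq_true, not_false_eq_true, List.filter_cons_of_neg, Real.exp_add]
        rw [← mul_assoc]
        refine mul_le_mul h3 ?_ ?_ ?_
        · rw [add_comm]; exact Real.add_one_le_exp _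
        · exact add_nonneg zero_le_one (inv_nonneg.mpr (F.fn_pos x hr).le)
        · exact mul_nonneg (cost_nonneg F hr _) (Real.exp_pos _).le
    · refine ⟨ω' ++ [x], ?_, ?_, ?_⟩
      · rw [listValue_append, h1]
        simp [List.filter_append, hx, mul_assoc]
      · intro c hc
        rcases List.mem_append.mp hc with hc | hc
        · rcases h2 c hc with h | h
          · exact Or.inl ⟨List.mem_append_left _ h.1, h.2⟩
          · exact Or.inr h
        · obtain rfl := List.mem_singleton.mp hc
          exact Or.inl ⟨by simp, hx⟩
      · simp only [List.filter_append, cost_append, hx, decide_true, List.filter_cons_of_pos,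
          List.filter_nil, cost_cons, cost_nil, add_zero, not_false_eq_true, decide_false,
          Bool.false_eq_true, List.filter_cons_of_neg]
        rw [add_mul]
        refine add_le_add h3 ?_
        exact le_mul_of_one_le_right (inv_nonneg.mpr (F.fn_pos x hr).le)
          (Real.one_le_exp (cost_nonneg F hr _))

/-- The letters of a word that satisfy a given predicate can be moved to the left; the cost of the
commutators that arise is controlled by the cost of the word. -/
theorem exists_pull (p : FormalComm k → Prop) [DecidablePred p]
    (v : Lex (Fin (d + 1) → ℝ)) (hp : ∀ c, p c → v ≤ w.weight c) {r : ℝ} (hr : 1 ≤ r)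
    (ω : List (FormalComm k)) :
    ∃ ω' : List (FormalComm k),
      listValue s ω = listValue s (ω.filter fun c => p c) * listValue s ω' ∧
      (∀ c ∈ ω', (c ∈ ω ∧ ¬ p c) ∨ v < w.weight c) ∧
      cost F r ω' ≤ cost F r ω * Real.exp (cost F r ω) ∧
      cost F r (ω.filter fun c => p c) ≤ cost F r ω := by
  obtain ⟨ω', h1, h2, h3⟩ := exists_pull_aux s w F p v hp hr ω
  have h := cost_filter_add F r p ω
  have ha := cost_nonneg F hr (ω.filter fun c => p c)
  have hb := cost_nonneg F hr (ω.filter fun c => ¬ p c)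
  refine ⟨ω', h1, h2, h3.trans ?_, by linarith⟩
  refine mul_le_mul (by linarith) (Real.exp_le_exp.mpr (by linarith)) (Real.exp_pos _).le ?_
  linarith

/-- The elements with a representation of cost at most `K` at scale `r` by a word with letters
in `W`. -/
def costBall (W : Set (FormalComm k)) (K r : ℝ) : Set G :=
  {g | ∃ ω : List (FormalComm k), (∀ c ∈ ω, c ∈ W) ∧ listValue s ω = g ∧ cost F r ω ≤ K}

/-- The volume of all cost balls with letters in `W` is `O(φ)`. -/
def VolumeLE (W : Set (FormalComm k)) (φ : ℝ → ℝ) : Prop :=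
  ∀ K : ℝ, ∃ C : ℝ, ∀ r : ℝ, 1 ≤ r →
    (costBall s F W K r).Finite ∧ ((costBall s F W K r).ncard : ℝ) ≤ C * φ r

theorem costBall_mono {W W' : Set (FormalComm k)} (h : W ⊆ W') {K K' : ℝ} (hK : K ≤ K') (r : ℝ) :
    costBall s F W K r ⊆ costBall s F W' K' r := by
  rintro g ⟨ω, h1, h2, h3⟩
  exact ⟨ω, fun c hc => h (h1 c hc), h2, h3.trans hK⟩

theorem VolumeLE.mono {W W' : Set (FormalComm k)} (h : W ⊆ W') {φ : ℝ → ℝ}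
    (hv : VolumeLE s F W' φ) : VolumeLE s F W φ := by
  intro K
  obtain ⟨C, hC⟩ := hv K
  refine ⟨C, fun r hr => ?_⟩
  have hsub := costBall_mono s F h le_rfl (K := K) r
  refine ⟨(hC r hr).1.subset hsub, le_trans ?_ (hC r hr).2⟩
  exact_mod_cast Set.ncard_le_ncard hsub (hC r hr).1

theorem volumeLE_of_trivial {W : Set (FormalComm k)} (h : ∀ c ∈ W, c.eval s = 1) :
    VolumeLE s F W fun _ => 1 := by
  intro K
  refine ⟨1, fun r _ => ?_⟩
  have hsub : costBall s F W K r ⊆ {1} := by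
    rintro g ⟨ω, h1, rfl, -⟩
    refine List.prod_eq_one fun x hx => ?_
    obtain ⟨c, hc, rfl⟩ := List.mem_map.mp hx
    exact h c (h1 c hc)
  refine ⟨(Set.finite_singleton _).subset hsub, ?_⟩
  have := Set.ncard_le_ncard hsub
  rw [Set.ncard_singleton] at this
  simpa using this

/-- Covering a set by translates. -/
theorem ncard_le_of_translates {A B : Set G} {ι : Type*} (I : Finset ι) (f : ι → G)
    (hB : B.Finite) (h : ∀ g ∈ A, ∃ i ∈ I, ∃ b ∈ B, g = f i * b) :
    A.Finite ∧ A.ncard ≤ I.card * B.ncard := by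
  classical
  have hsub : A ⊆ ((I ×ˢ hB.toFinset).image fun p => f p.1 * p.2 : Finset G) := by
    intro g hg
    obtain ⟨i, hi, b, hb, rfl⟩ := h g hg
    rw [Finset.mem_coe, Finset.mem_image]
    exact ⟨(i, b), by simp [hi, hb], rfl⟩
  refine ⟨(Finset.finite_toSet _).subset hsub, ?_⟩
  refine (Set.ncard_le_ncard hsub (Finset.finite_toSet _)).trans ?_
  rw [Set.ncard_coe_finset]
  refine Finset.card_image_le.trans ?_
  rw [Finset.card_product, Set.ncard_eq_toFinset_card B hB]

theorem listValue_replicate (n : ℕ) (ω : List (FormalComm k)) :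
    listValue s (List.replicate n ω).flatten = listValue s ω ^ n := by
  induction n with
  | zero => simp
  | succ n ih => rw [List.replicate_succ, List.flatten_cons, listValue_append, ih, pow_succ']

theorem cost_replicate (r : ℝ) (n : ℕ) (ω : List (FormalComm k)) :
    cost F r (List.replicate n ω).flatten = n * cost F r ω := by
  induction n with
  | zero => simp
  | succ n ih =>
    rw [List.replicate_succ, List.flatten_cons, cost_append, ih]
    push_cast
    ring

variable {w F}

/-- By compatibility a letter at least as heavy as `a` costs, up to a constant independent of `r`,
no more than `a`. -/
theorem cost_le_of_weight_ge (hF : Compatible w F) (a : FormalComm k) (u : List (FormalComm k))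
    (hu : ∀ c ∈ u, w.weight a ≤ w.weight c) :
    ∃ C : ℝ, 0 ≤ C ∧ ∀ r : ℝ, 1 ≤ r → cost F r u ≤ C * (F.fn a r)⁻¹ := by
  induction u with
  | nil => exact ⟨0, le_rfl, by simp⟩
  | cons c u ih =>
    obtain ⟨C, hC0, hC⟩ := ih fun c' hc' => hu c' (List.mem_cons_of_mem _ hc')
    obtain ⟨D, hD1, hD⟩ := (hF a c).mp (hu c List.mem_cons_self)
    refine ⟨D + C, by linarith, fun r hr => ?_⟩
    rw [cost_cons, add_mul]
    refine add_le_add ?_ (hC r hr)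
    rw [← div_eq_mul_inv, le_div_iff₀ (F.fn_pos a hr), ← div_eq_inv_mul,
      div_le_iff₀ (F.fn_pos c hr)]
    exact hD r hr

variable {s}

/-- Adding a letter of which a positive power is a word in the given letters. -/
theorem VolumeLE.of_pow (hF : Compatible w F) {W W' : Set (FormalComm k)} {φ : ℝ → ℝ}
    (a : FormalComm k) (hW : W ⊆ insert a W')
    (hge : ∀ c ∈ W', w.weight a ≤ w.weight c) (hgt : ∀ c, w.weight a < w.weight c → c ∈ W')
    {q : ℕ} (hq : 0 < q) {u : List (FormalComm k)} (hu : ∀ c ∈ u, c ∈ W')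
    (huq : listValue s u = a.eval s ^ q) (h : VolumeLE s F W' φ) : VolumeLE s F W φ := by
  classical
  intro K
  obtain ⟨D, hD0, hD⟩ := cost_le_of_weight_ge hF a u fun c hc => hge c (hu c hc)
  -- The first summand pays for the copies of `u`: at most `|K| F_a(r)` of them, each of cost at
  -- most `D / F_a(r)`. The second pays for the remainder after collecting `a`. Absolute values are
  -- taken because `K` is an arbitrary real.
  obtain ⟨C, hC⟩ := h (|K| * D + |K| * Real.exp |K|)
  refine ⟨q * C, fun r hr => ?_⟩
  obtain ⟨hfin, hcard⟩ := hC r hr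
  have key := ncard_le_of_translates (A := costBall s F W K r) (Finset.range q)
    (fun i => a.eval s ^ i) hfin ?_
  · refine ⟨key.1, ?_⟩
    have h1 : ((costBall s F W K r).ncard : ℝ) ≤ q * (costBall s F W'
        (|K| * D + |K| * Real.exp |K|) r).ncard := by
      have := key.2
      rw [Finset.card_range] at this
      exact_mod_cast this
    rw [mul_assoc]
    exact h1.trans (mul_le_mul_of_nonneg_left hcard q.cast_nonneg)
  · rintro _ ⟨ω, hω, rfl, hK⟩
    obtain ⟨ω', h1, h2, h3, h4⟩ := exists_pull s w F (fun c => c = a) (w.weight a)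
      (fun c hc => hc ▸ le_rfl) hr ω
    set n := (ω.filter fun c => c = a).length with hn
    have hrep : (ω.filter fun c => c = a) = List.replicate n a := by
      rw [List.eq_replicate_iff]
      refine ⟨rfl, fun c hc => ?_⟩
      simpa using (List.mem_filter.mp hc).2
    have hval : listValue s (ω.filter fun c => c = a) = a.eval s ^ n := by
      rw [hrep, listValue, List.map_replicate, List.prod_replicate]
    have hK' : cost F r ω ≤ |K| := hK.trans (le_abs_self K)
    have hnK : (n : ℝ) * (F.fn a r)⁻¹ ≤ |K| := by
      rw [← cost_eq_length_mul F r (F.fn a r) (ω.filter fun c => c = a)]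
      · exact h4.trans hK'
      · intro c hc
        rw [hrep] at hc
        rw [List.eq_of_mem_replicate hc]
    -- Write `a ^ n = a ^ (n % q) * (a ^ q) ^ (n / q)` and replace each `a ^ q` by `u`; only `q`
    -- translates remain.
    refine ⟨n % q, Finset.mem_range.mpr (Nat.mod_lt _ hq), _,
      ⟨(List.replicate (n / q) u).flatten ++ ω', ?_, rfl, ?_⟩, ?_⟩
    · intro c hc
      rcases List.mem_append.mp hc with hc | hc
      · obtain ⟨l, hl, hcl⟩ := List.mem_flatten.mp hc
        rw [List.eq_of_mem_replicate hl] at hcl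
        exact hu c hcl
      · rcases h2 c hc with h | h
        · exact (hW (hω c h.1)).resolve_left h.2
        · exact hgt c h
    · rw [cost_append, cost_replicate]
      refine add_le_add ?_ ?_
      · have hnq : ((n / q : ℕ) : ℝ) ≤ n := by exact_mod_cast Nat.div_le_self n q
        have hpos := inv_nonneg.mpr (F.fn_pos a hr).le
        calc ((n / q : ℕ) : ℝ) * cost F r u ≤ n * (D * (F.fn a r)⁻¹) :=
              mul_le_mul hnq (hD r hr) (cost_nonneg F hr u) n.cast_nonneg
          _ = n * (F.fn a r)⁻¹ * D := by ring
          _ ≤ |K| * D := mul_le_mul_of_nonneg_right hnK hD0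
      · exact h3.trans (mul_le_mul hK' (Real.exp_le_exp.mpr hK') (Real.exp_pos _).le (abs_nonneg K))
    · rw [h1, hval, listValue_append, listValue_replicate, huq, ← mul_assoc, ← pow_mul, ← pow_add,
        Nat.mod_add_div]

/-- Adding a letter and its inverse. -/
theorem VolumeLE.mul_fn {W W' : Set (FormalComm k)} {φ : ℝ → ℝ}
    (hφ : ∀ r : ℝ, 1 ≤ r → 0 ≤ φ r) (a : FormalComm k) (hW : W ⊆ insert a (insert a.inv W'))
    (hgt : ∀ c, w.weight a < w.weight c → c ∈ W') (h : VolumeLE s F W' φ) :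
    VolumeLE s F W fun r => F.fn a r * φ r := by
  classical
  intro K
  obtain ⟨C, hC⟩ := h (|K| * Real.exp |K|)
  refine ⟨(2 * |K| + 1) * |C|, fun r hr => ?_⟩
  obtain ⟨hfin, hcard⟩ := hC r hr
  have hpos := F.fn_pos a hr
  -- Each collected letter `a` or `a.inv` costs `1 / F_a(r)`, so at most `N` of them occur and their
  -- product is a power of `a` with exponent in `[-N, N]`.
  set N := ⌊|K| * F.fn a r⌋₊ with hN
  have hNle : (N : ℝ) ≤ |K| * F.fn a r := Nat.floor_le (mul_nonneg (abs_nonneg K) hpos.le)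
  have key := ncard_le_of_translates (A := costBall s F W K r) (Finset.Icc (-(N : ℤ)) N)
    (fun i => a.eval s ^ i) hfin ?_
  · refine ⟨key.1, ?_⟩
    have hI : ((Finset.Icc (-(N : ℤ)) N).card : ℝ) = 2 * N + 1 := by
      rw [Int.card_Icc]
      have : ((N : ℤ) + 1 - -N).toNat = 2 * N + 1 := by omega
      rw [this]
      push_cast
      ring
    have h1 : ((costBall s F W K r).ncard : ℝ) ≤
        (2 * N + 1) * (costBall s F W' (|K| * Real.exp |K|) r).ncard := by
      rw [← hI]
      exact_mod_cast key.2
    have h2 : C * φ r ≤ |C| * φ r := mul_le_mul_of_nonneg_right (le_abs_self C) (hφ r hr)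
    have h3 : (2 * N + 1 : ℝ) ≤ (2 * |K| + 1) * F.fn a r := by
      have := F.one_le_fn a hr
      nlinarith
    calc ((costBall s F W K r).ncard : ℝ) ≤ _ := h1
      _ ≤ (2 * |K| + 1) * F.fn a r * (|C| * φ r) :=
        mul_le_mul h3 (hcard.trans h2) (Nat.cast_nonneg _) (by positivity)
      _ = _ := by ring
  · rintro _ ⟨ω, hω, rfl, hK⟩
    obtain ⟨ω', h1, h2, h3, h4⟩ := exists_pull s w F (fun c => c = a ∨ c = a.inv) (w.weight a)
      (by rintro c (rfl | rfl); exacts [le_rfl, (FormalComm.weight_inv w a).ge]) hr ω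
    have hK' : cost F r ω ≤ |K| := hK.trans (le_abs_self K)
    set η := ω.filter fun c => c = a ∨ c = a.inv with hη
    have hmem : ∀ c ∈ η, c = a ∨ c = a.inv := fun c hc => by
      simpa using (List.mem_filter.mp hc).2
    have hlen : η.length ≤ N := by
      have hc : cost F r η = η.length * (F.fn a r)⁻¹ := by
        refine cost_eq_length_mul F r _ η fun c hc => ?_
        rcases hmem c hc with rfl | rfl
        · rfl
        · rw [FormalComm.fn_inv]
      refine Nat.le_floor ?_
      rw [← div_le_iff₀ hpos, div_eq_mul_inv, ← hc]
      exact h4.trans hK'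
    have hzpow : ∀ η : List (FormalComm k), (∀ c ∈ η, c = a ∨ c = a.inv) →
        ∃ m : ℤ, |m| ≤ η.length ∧ listValue s η = a.eval s ^ m := by
      intro η hη
      induction η with
      | nil => exact ⟨0, by simp, by simp⟩
      | cons c η ih =>
        obtain ⟨m, hm, hv⟩ := ih fun c' hc' => hη c' (List.mem_cons_of_mem _ hc')
        rcases hη c List.mem_cons_self with rfl | rfl
        · refine ⟨1 + m, ?_, by rw [listValue_cons, hv, zpow_add, zpow_one]⟩
          rw [List.length_cons]
          push_cast
          rw [abs_le] at hm ⊢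
          omega
        · refine ⟨-1 + m, ?_, by
            rw [listValue_cons, hv, zpow_add, zpow_neg_one, FormalComm.eval_inv]⟩
          rw [List.length_cons]
          push_cast
          rw [abs_le] at hm ⊢
          omega
    obtain ⟨m, hm, hv⟩ := hzpow η hmem
    refine ⟨m, ?_, _, ⟨ω', ?_, rfl, ?_⟩, ?_⟩
    · rw [Finset.mem_Icc]
      rw [abs_le] at hm
      omega
    · intro c hc
      rcases h2 c hc with h | h
      · have := hW (hω c h.1)
        simp only [Set.mem_insert_iff] at this
        tauto
      · exact hgt c h
    · exact h3.trans (mul_le_mul hK' (Real.exp_le_exp.mpr hK') (Real.exp_pos _).le (abs_nonneg K))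
    · rw [h1, hv]

end Words

/-! ### Free subfamilies of generating families of abelian groups. -/

/-- Any finite generating family of an abelian group contains a free family, indexed by the
torsion-free rank, whose span has torsion cokernel. -/
theorem exists_linearIndependent_subfamily {M ι : Type*} [AddCommGroup M] [Finite ι] (v : ι → M)
    (hv : Submodule.span ℤ (Set.range v) = ⊤) :
    ∃ b : Fin (Module.finrank ℤ M) → ι, LinearIndependent ℤ (v ∘ b) ∧
      ∀ x : M, ∃ q : ℕ, 0 < q ∧ q • x ∈ Submodule.span ℤ (Set.range (v ∘ b)) := by
  classical
  obtain ⟨I, hI, hmax⟩ := exists_maximal_linearIndepOn ℤ v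
  have := Fintype.ofFinite I
  set N := Submodule.span ℤ (v '' I) with hN
  have htors : ∀ x : M, ∃ a : ℤ, a ≠ 0 ∧ a • x ∈ N := by
    intro x
    have hx : x ∈ Submodule.span ℤ (Set.range v) := hv ▸ Submodule.mem_top
    induction hx using Submodule.span_induction with
    | mem x hx =>
      obtain ⟨i, rfl⟩ := hx
      by_cases hi : i ∈ I
      · exact ⟨1, one_ne_zero, by
          rw [one_smul]; exact Submodule.subset_span ⟨i, hi, rfl⟩⟩
      · exact hmax i hi
    | zero => exact ⟨1, one_ne_zero, by simp⟩
    | add x y _ _ hx hy =>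
      obtain ⟨a, ha, hax⟩ := hx
      obtain ⟨b, hb, hby⟩ := hy
      refine ⟨a * b, mul_ne_zero ha hb, ?_⟩
      rw [smul_add]
      refine add_mem ?_ ?_
      · rw [mul_comm, mul_smul]; exact N.smul_mem _ hax
      · rw [mul_smul]; exact N.smul_mem _ hby
    | smul c x _ hx =>
      obtain ⟨a, ha, hax⟩ := hx
      exact ⟨a, ha, by rw [smul_comm]; exact N.smul_mem _ hax⟩
  have hrange : Set.range (fun i : I => v i) = v '' I := by
    rw [Set.image_eq_range]
  have hcard : Module.finrank ℤ M = Fintype.card I := by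
    -- The quotient is torsion by maximality of `I`, so additivity of the rank gives `M` the rank of
    -- the free module `N`.
    have h0 : Module.rank ℤ (M ⧸ N) = 0 := by
      rw [rank_eq_zero_iff]
      intro x
      obtain ⟨x, rfl⟩ := N.mkQ_surjective x
      obtain ⟨a, ha, hax⟩ := htors x
      refine ⟨a, ha, ?_⟩
      rw [← map_smul]
      exact (Submodule.Quotient.mk_eq_zero N).mpr hax
    have h1 := rank_quotient_add_rank_of_isDomain N
    rw [h0, zero_add] at h1
    have h2 : Module.finrank ℤ N = Fintype.card I := by
      rw [hN, ← hrange]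
      exact finrank_span_eq_card hI
    rw [← h2, Module.finrank, Module.finrank, h1]
  let e : Fin (Module.finrank ℤ M) ≃ I := (Fintype.equivFinOfCardEq hcard.symm).symm
  refine ⟨fun i => (e i : ι), ?_, ?_⟩
  · exact (linearIndependent_equiv e).mpr hI
  · intro x
    obtain ⟨a, ha, hax⟩ := htors x
    refine ⟨a.natAbs, Int.natAbs_pos.mpr ha, ?_⟩
    have hset : Set.range (v ∘ fun i => (e i : ι)) = v '' I := by
      rw [← hrange]
      exact e.surjective.range_comp (fun i : I => v i)
    rw [hset]
    rcases Int.natAbs_eq a with h | h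
    · rw [h, natCast_zsmul] at hax
      exact hax
    · rw [h, neg_smul, natCast_zsmul] at hax
      exact (N.neg_mem_iff).mp hax

/-! ### Free families in the layers, and the upper bound for one layer. -/

section Selection

variable {k d : ℕ} {G : Type*} [Group G] (s : Fin k → G) (w : WeightSystem k d)

/-- The class of a formal commutator of weight `w.level j` in the `j`-th graded quotient. -/
def gradedClass {j : ℕ} {c : FormalComm k} (h : w.weight c = w.level j) :
    Additive (Graded s w j) :=
  Additive.ofMul (QuotientGroup.mk ⟨c.eval s, eval_mem_filtration s w h.ge⟩ : Graded s w j)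

variable {s w}

theorem level_le_of_lt {j : ℕ} {c : FormalComm k} (h : w.level j < w.weight c) :
    w.level (j + 1) ≤ w.weight c :=
  (isLeast_level_succ w j ⟨c, h⟩).2 ⟨⟨c, rfl⟩, h⟩

theorem filtration_succ_le [NeZero k] (j : ℕ) : filtration s w (j + 1) ≤ filtration s w j := by
  refine Subgroup.closure_mono (Set.image_mono fun c hc => ?_)
  exact (level_lt_succ w j).le.trans hc

theorem filtration_normal (hs : Subgroup.closure (Set.range s) = ⊤) (j : ℕ) :
    (filtration s w j).Normal :=
  ⟨fun _ hx _ => conj_mem_filtration s w (hs ▸ Subgroup.mem_top _) hx⟩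

/-- The abelian statement is applied to the classes of `A`, which is finite since only finitely many
commutators have a given weight. A relation placing `q` times the class of `c` in the span lifts to
the group, up to an element of the next term. -/
theorem exists_independent [NeZero k] (j : ℕ) (A : Set (FormalComm k))
    (hA : ∀ c ∈ A, w.weight c = w.level j)
    (hgen : filtration s w j ≤
      Subgroup.closure (FormalComm.eval s '' A) ⊔ filtration s w (j + 1)) :
    ∃ (b : Fin (gradedRank s w j) → FormalComm k) (hb : ∀ i, w.weight (b i) = w.level j),
      (∀ i, b i ∈ A) ∧ (LinearIndependent ℤ fun i => gradedClass s w (hb i)) ∧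
      ∀ c, w.weight c = w.level j → ∃ q : ℕ, 0 < q ∧
        c.eval s ^ q ∈ Subgroup.closure (FormalComm.eval s '' Set.range b) ⊔
          filtration s w (j + 1) := by
  have hfin : Finite A :=
    ((finite_weight_le w (w.level j)).subset fun c hc => (hA c hc).le).to_subtype
  let v : A → Additive (Graded s w j) := fun c => gradedClass s w (hA c.1 c.2)
  have hspan : Submodule.span ℤ (Set.range v) = ⊤ := by
    rw [eq_top_iff]
    intro x _
    have hmem : ∀ g ∈ Subgroup.closure (FormalComm.eval s '' A ∪ filtration s w (j + 1)),
        ∃ h : g ∈ filtration s w j, Additive.ofMul (QuotientGroup.mk ⟨g, h⟩ : Graded s w j) ∈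
          Submodule.span ℤ (Set.range v) := by
      intro g hg
      induction hg using Subgroup.closure_induction with
      | mem g hg =>
        rcases hg with ⟨c, hc, rfl⟩ | hg
        · exact ⟨eval_mem_filtration s w (hA c hc).ge, Submodule.subset_span ⟨⟨c, hc⟩, rfl⟩⟩
        · refine ⟨filtration_succ_le j hg, ?_⟩
          have h0 : (QuotientGroup.mk ⟨g, filtration_succ_le j hg⟩ : Graded s w j) = 1 := by
            rw [QuotientGroup.eq_one_iff, Subgroup.mem_subgroupOf]
            exact hg
          rw [h0]
          exact zero_mem _
      | one => exact ⟨one_mem _, zero_mem _⟩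
      | mul a b _ _ ha hb =>
        obtain ⟨ha1, ha2⟩ := ha
        obtain ⟨hb1, hb2⟩ := hb
        exact ⟨mul_mem ha1 hb1, add_mem ha2 hb2⟩
      | inv a _ ha =>
        obtain ⟨ha1, ha2⟩ := ha
        exact ⟨inv_mem ha1, neg_mem ha2⟩
    obtain ⟨⟨g, hg⟩, hx⟩ := QuotientGroup.mk_surjective (Additive.toMul x)
    have hg' : g ∈ Subgroup.closure (FormalComm.eval s '' A ∪ filtration s w (j + 1)) := by
      rw [Subgroup.closure_union, Subgroup.closure_eq]
      exact hgen hg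
    obtain ⟨_, h⟩ := hmem g hg'
    rw [hx] at h
    exact h
  obtain ⟨b, hb, hq⟩ := exists_linearIndependent_subfamily v hspan
  refine ⟨fun i => (b i).1, fun i => hA _ (b i).2, fun i => (b i).2, hb, fun c hc => ?_⟩
  obtain ⟨q, hq0, hq⟩ := hq (gradedClass s w hc)
  refine ⟨q, hq0, ?_⟩
  set H := Subgroup.closure (FormalComm.eval s '' Set.range fun i => (b i).1) ⊔
    filtration s w (j + 1) with hH
  have hle : filtration s w (j + 1) ≤ H := le_sup_right
  have key : ∀ x ∈ Submodule.span ℤ (Set.range (v ∘ b)), ∃ g : filtration s w j,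
      (g : G) ∈ H ∧ Additive.ofMul (QuotientGroup.mk g : Graded s w j) = x := by
    intro x hx
    induction hx using Submodule.span_induction with
    | mem x hx =>
      obtain ⟨i, rfl⟩ := hx
      exact ⟨⟨_, eval_mem_filtration s w (hA _ (b i).2).ge⟩,
        Subgroup.mem_sup_left (Subgroup.subset_closure ⟨_, ⟨i, rfl⟩, rfl⟩), rfl⟩
    | zero => exact ⟨1, one_mem _, rfl⟩
    | add x y _ _ hx hy =>
      obtain ⟨g, hg, rfl⟩ := hx
      obtain ⟨g', hg', rfl⟩ := hy
      exact ⟨g * g', mul_mem hg hg', rfl⟩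
    | smul m x _ hx =>
      obtain ⟨g, hg, rfl⟩ := hx
      refine ⟨g ^ m, ?_, rfl⟩
      rw [Subgroup.coe_zpow]
      exact zpow_mem hg m
  obtain ⟨g, hg, hgx⟩ := key _ hq
  have h1 : (QuotientGroup.mk g : Graded s w j) =
      QuotientGroup.mk (⟨c.eval s, eval_mem_filtration s w hc.ge⟩ ^ q) := hgx
  rw [QuotientGroup.eq, Subgroup.mem_subgroupOf] at h1
  have h2 := mul_mem hg (hle h1)
  change c.eval s ^ q ∈ H
  simpa using h2

/-- Elements of the subgroup generated by the images of a set of formal commutators are images of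
words in these commutators and their formal inverses. -/
theorem exists_listValue_of_mem_closure {X : Set (FormalComm k)} {g : G}
    (hg : g ∈ Subgroup.closure (FormalComm.eval s '' X)) :
    ∃ u : List (FormalComm k), (∀ c ∈ u, c ∈ X ∨ c.inv ∈ X) ∧ listValue s u = g := by
  have hinv : ∀ c : FormalComm k, c.inv.inv = c := by
    intro c
    cases c <;> simp [FormalComm.inv]
  induction hg using Subgroup.closure_induction with
  | mem g hg => obtain ⟨c, hc, rfl⟩ := hg; exact ⟨[c], by simpa using Or.inl hc, by simp⟩
  | one => exact ⟨[], by simp, rfl⟩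
  | mul a b _ _ ha hb =>
    obtain ⟨u, hu, rfl⟩ := ha
    obtain ⟨u', hu', rfl⟩ := hb
    refine ⟨u ++ u', fun c hc => ?_, listValue_append s u u'⟩
    exact (List.mem_append.mp hc).elim (hu c) (hu' c)
  | inv a ha' ha =>
    clear ha'
    obtain ⟨u, hu, rfl⟩ := ha
    refine ⟨(u.map FormalComm.inv).reverse, fun c hc => ?_, ?_⟩
    · rw [List.mem_reverse, List.mem_map] at hc
      obtain ⟨c, hc, rfl⟩ := hc
      rw [hinv]
      exact (hu c hc).symm
    · clear hu
      induction u with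
      | nil => simp
      | cons c u ih =>
        rw [List.map_cons, List.reverse_cons, listValue_append, ih]
        simp [FormalComm.eval_inv]

variable {F : WeightFunctions k}

/-- One step of the upper bound, from the `(j+1)`-st to the `j`-th term of the filtration. -/
theorem volumeLE_step [NeZero k] (hF : Compatible w F) (j : ℕ)
    (b : Fin (gradedRank s w j) → FormalComm k) (hb : ∀ i, w.weight (b i) = w.level j)
    (hq : ∀ c, w.weight c = w.level j → ∃ q : ℕ, 0 < q ∧
        c.eval s ^ q ∈ Subgroup.closure (FormalComm.eval s '' Set.range b) ⊔
          filtration s w (j + 1))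
    {φ : ℝ → ℝ} (hφ : ∀ r : ℝ, 1 ≤ r → 0 ≤ φ r)
    (h : VolumeLE s F {c | w.level (j + 1) ≤ w.weight c} φ) :
    VolumeLE s F {c | w.level j ≤ w.weight c} fun r => (∏ i, F.fn (b i) r) * φ r := by
  classical
  set U := {c | w.level (j + 1) ≤ w.weight c} with hU
  have hUge : ∀ c ∈ U, w.level j ≤ w.weight c := fun c hc => (level_lt_succ w j).le.trans hc
  have hUgt : ∀ c, w.level j < w.weight c → c ∈ U := fun c hc => level_le_of_lt hc
  -- The chosen commutators enter one at a time, with their formal inverses; each contributes one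
  -- factor.
  have step1 : ∀ I : Finset (Fin (gradedRank s w j)),
      VolumeLE s F (U ∪ {c | ∃ i ∈ I, c = b i ∨ c = (b i).inv})
        fun r => (∏ i ∈ I, F.fn (b i) r) * φ r := by
    intro I
    induction I using Finset.induction_on with
    | empty => simpa using h
    | insert i I hi ih =>
      have := VolumeLE.mul_fn (w := w) (W := U ∪ {c | ∃ i' ∈ insert i I, c = b i' ∨ c = (b i').inv})
        ?_ (b i) ?_ ?_ ih
      · simpa only [Finset.prod_insert hi, mul_assoc] using this
      · exact fun r hr => mul_nonneg (Finset.prod_nonneg fun i _ => (F.fn_pos _ hr).le) (hφ r hr)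
      · rintro c (hc | ⟨i', hi', hc⟩)
        · exact Or.inr (Or.inr (Or.inl hc))
        · rcases Finset.mem_insert.mp hi' with rfl | hi'
          · exact hc.elim Or.inl fun h => Or.inr (Or.inl h)
          · exact Or.inr (Or.inr (Or.inr ⟨i', hi', hc⟩))
      · exact fun c hc => Or.inl (hUgt c (hb i ▸ hc))
  set V := U ∪ {c | ∃ i ∈ Finset.univ, c = b i ∨ c = (b i).inv} with hV
  have hVge : ∀ c ∈ V, w.level j ≤ w.weight c := by
    rintro c (hc | ⟨i, -, rfl | rfl⟩)
    · exact hUge c hc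
    · exact (hb i).ge
    · rw [FormalComm.weight_inv, hb]
  have hfin : {c | w.weight c = w.level j}.Finite :=
    (finite_weight_le w (w.level j)).subset fun c hc => le_of_eq hc
  -- The remaining commutators of this weight are finite in number and torsion modulo the chosen
  -- ones and the next term, so the order of growth does not change.
  have step2 : ∀ A : Finset (FormalComm k), (∀ c ∈ A, w.weight c = w.level j) →
      VolumeLE s F (V ∪ A) fun r => (∏ i, F.fn (b i) r) * φ r := by
    intro A
    induction A using Finset.induction_on with
    | empty =>
      intro _
      rw [Finset.coe_empty, Set.union_empty]
      exact step1 Finset.univ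
    | insert a A _ ih =>
      intro hA
      have ha := hA a (Finset.mem_insert_self a A)
      obtain ⟨q, hq0, hmem⟩ := hq a ha
      rw [filtration, ← Subgroup.closure_union, ← Set.image_union] at hmem
      obtain ⟨u, hu, hval⟩ := exists_listValue_of_mem_closure hmem
      refine VolumeLE.of_pow hF a (W' := V ∪ A) ?_ ?_ ?_ hq0 ?_ hval
        (ih fun c hc => hA c (Finset.mem_insert_of_mem hc))
      · rw [Finset.coe_insert]
        rintro c (hc | rfl | hc)
        · exact Or.inr (Or.inl hc)
        · exact Or.inl rfl
        · exact Or.inr (Or.inr hc)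
      · rintro c (hc | hc)
        · exact ha ▸ hVge c hc
        · rw [ha, hA c (Finset.mem_insert_of_mem hc)]
      · exact fun c hc => Or.inl (Or.inl (hUgt c (ha ▸ hc)))
      · intro c hc
        refine Or.inl ?_
        rcases hu c hc with (⟨i, rfl⟩ | h) | (⟨i, hi⟩ | h)
        · exact Or.inr ⟨i, Finset.mem_univ i, Or.inl rfl⟩
        · exact Or.inl h
        · refine Or.inr ⟨i, Finset.mem_univ i, Or.inr ?_⟩
          rw [hi]
          cases c <;> simp [FormalComm.inv]
        · refine Or.inl ?_
          rw [Set.mem_ofPred_eq, FormalComm.weight_inv] at h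
          exact h
  refine VolumeLE.mono s F ?_ (step2 hfin.toFinset fun c hc => by simpa using hc)
  intro c hc
  rcases (show w.level j ≤ w.weight c from hc).eq_or_lt with h | h
  · exact Or.inr (by simpa using h.symm)
  · exact Or.inl (Or.inl (hUgt c h))

end Selection

/-! ### Consequences of doubling. -/

section Growth

variable {k : ℕ} {F : WeightFunctions k}

/-- Under the dilation that doubles the generating functions, one factor of a bracket doubles and
the other does not decrease. Hence a single `l` serves all formal commutators, as infinite alphabets
require. -/
theorem WeightFunctions.Doubling.exists_dilation (hF : F.Doubling) (M : ℝ) :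
    ∃ l : ℝ, 1 ≤ l ∧ ∀ c : FormalComm k, ∀ r : ℝ, 1 ≤ r → M * F.fn c r ≤ F.fn c (l * r) := by
  obtain ⟨C, hC1, hC⟩ := hF
  have hone : ∀ r : ℝ, 1 ≤ r → 1 ≤ C * r := fun r hr => one_le_mul_of_one_le_of_one_le hC1 hr
  have h2 : ∀ c : FormalComm k, ∀ r : ℝ, 1 ≤ r → 2 * F.fn c r ≤ F.fn c (C * r) := by
    intro c
    induction c with
    | letter i b => exact fun r hr => (hC i r hr).1
    | bracket a b ha hb =>
      intro r hr
      have := mul_le_mul (ha r hr) (F.fn_mono b hr (hone r hr) (le_mul_of_one_le_left (by linarith) hC1))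
        (F.fn_pos b hr).le (F.fn_pos a (hone r hr)).le
      simpa only [WeightFunctions.fn, mul_assoc] using this
  have hm : ∀ m : ℕ, ∀ c : FormalComm k, ∀ r : ℝ, 1 ≤ r →
      2 ^ m * F.fn c r ≤ F.fn c (C ^ m * r) := by
    intro m c
    induction m with
    | zero => intro r _; simp
    | succ m ih =>
      intro r hr
      have h1 := ih (C * r) (hone r hr)
      have h3 := h2 c r hr
      calc 2 ^ (m + 1) * F.fn c r = 2 ^ m * (2 * F.fn c r) := by ring
        _ ≤ 2 ^ m * F.fn c (C * r) := mul_le_mul_of_nonneg_left h3 (by positivity)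
        _ ≤ F.fn c (C ^ m * (C * r)) := h1
        _ = F.fn c (C ^ (m + 1) * r) := by ring_nf
  obtain ⟨m, hmM⟩ := pow_unbounded_of_one_lt M (one_lt_two)
  exact ⟨C ^ m, one_le_pow₀ hC1, fun c r hr =>
    (mul_le_mul_of_nonneg_right hmM.le (F.fn_pos c hr).le).trans (hm m c r hr)⟩

theorem WeightFunctions.Doubling.gen_dilation_le (hF : F.Doubling) {l : ℝ} (hl : 1 ≤ l) :
    ∃ C : ℝ, 1 ≤ C ∧ ∀ i, ∀ r : ℝ, 1 ≤ r → F.gen i (l * r) ≤ C * F.gen i r := by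
  obtain ⟨C, hC1, hC⟩ := hF
  obtain ⟨m, hm⟩ := pow_unbounded_of_one_lt l (one_lt_two)
  refine ⟨C ^ m, one_le_pow₀ hC1, fun i r hr => ?_⟩
  have hpow : ∀ m : ℕ, (1 : ℝ) ≤ 2 ^ m := fun m => one_le_pow₀ one_le_two
  have key : F.gen i (2 ^ m * r) ≤ C ^ m * F.gen i r := by
    clear hm
    induction m with
    | zero => simp
    | succ m ih =>
      have h1 := (hC i (2 ^ m * r) (one_le_mul_of_one_le_of_one_le (hpow m) hr)).2
      calc F.gen i (2 ^ (m + 1) * r) = F.gen i (2 * (2 ^ m * r)) := by ring_nf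
        _ ≤ C * F.gen i (2 ^ m * r) := h1
        _ ≤ C * (C ^ m * F.gen i r) := mul_le_mul_of_nonneg_left ih (by linarith)
        _ = _ := by ring
  refine le_trans (F.mono i ?_ ?_ ?_) key
  · exact one_le_mul_of_one_le_of_one_le hl hr
  · exact one_le_mul_of_one_le_of_one_le (hpow m) hr
  · exact mul_le_mul_of_nonneg_right hm.le (by linarith)

/-- In this direction the constants of the two factors multiply, so `C` depends on `c`. -/
theorem WeightFunctions.Doubling.fn_dilation_le (hF : F.Doubling) {l : ℝ} (hl : 1 ≤ l)
    (c : FormalComm k) :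
    ∃ C : ℝ, 1 ≤ C ∧ ∀ r : ℝ, 1 ≤ r → F.fn c (l * r) ≤ C * F.fn c r := by
  induction c with
  | letter i b =>
    obtain ⟨C, h1, h⟩ := hF.gen_dilation_le hl
    exact ⟨C, h1, h i⟩
  | bracket a b ha hb =>
    obtain ⟨C, hC1, hC⟩ := ha
    obtain ⟨D, hD1, hD⟩ := hb
    refine ⟨C * D, one_le_mul_of_one_le_of_one_le hC1 hD1, fun r hr => ?_⟩
    have hlr : 1 ≤ l * r := one_le_mul_of_one_le_of_one_le hl hr
    have := mul_le_mul (hC r hr) (hD r hr) (F.fn_pos b hlr).le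
      (mul_nonneg (by linarith) (F.fn_pos a hr).le)
    calc F.fn (.bracket a b) (l * r) ≤ _ := this
      _ = C * D * F.fn (.bracket a b) r := by simp only [WeightFunctions.fn]; ring

end Growth

/-! ### Elements represented by words with bounded degrees. -/

section WordBalls

variable {k d : ℕ} {G : Type*} [Group G] (s : Fin k → G) (w : WeightSystem k d)
  (F : WeightFunctions k) (Γ : Set (FormalComm k))

/-- The elements represented by a word over `Γ` in which each `c` occurs at most `K F_c(r)`
times. -/
def wordBall (K r : ℝ) : Set G :=
  {g | ∃ ω : List (FormalComm k × Bool), (∀ l ∈ ω, l.1 ∈ Γ) ∧ wordValue s ω = g ∧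
    ∀ c ∈ Γ, (wordDeg c ω : ℝ) ≤ K * F.fn c r}

variable {s F Γ}

theorem wordBall_mono {K K' r : ℝ} (hr : 1 ≤ r) (h : K ≤ K') :
    wordBall s F Γ K r ⊆ wordBall s F Γ K' r := by
  rintro g ⟨ω, h1, h2, h3⟩
  exact ⟨ω, h1, h2, fun c hc =>
    (h3 c hc).trans (mul_le_mul_of_nonneg_right h (F.fn_pos c hr).le)⟩

theorem one_mem_wordBall {K r : ℝ} (hK : 0 ≤ K) (hr : 1 ≤ r) : (1 : G) ∈ wordBall s F Γ K r := by
  refine ⟨[], by simp, rfl, fun c _ => ?_⟩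
  simpa [wordDeg] using mul_nonneg hK (F.fn_pos c hr).le

theorem mul_mem_wordBall {K K' r : ℝ} {g g' : G} (hg : g ∈ wordBall s F Γ K r)
    (hg' : g' ∈ wordBall s F Γ K' r) : g * g' ∈ wordBall s F Γ (K + K') r := by
  obtain ⟨ω, h1, rfl, h3⟩ := hg
  obtain ⟨ω', h1', rfl, h3'⟩ := hg'
  refine ⟨ω ++ ω', fun l hl => (List.mem_append.mp hl).elim (h1 l) (h1' l), ?_, fun c hc => ?_⟩
  · simp [wordValue]
  · rw [wordDeg, List.countP_append, add_mul]
    push_cast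
    exact add_le_add (h3 c hc) (h3' c hc)

theorem inv_mem_wordBall {K r : ℝ} {g : G} (hg : g ∈ wordBall s F Γ K r) :
    g⁻¹ ∈ wordBall s F Γ K r := by
  obtain ⟨ω, h1, rfl, h3⟩ := hg
  refine ⟨(ω.map fun l => (l.1, !l.2)).reverse, fun l hl => ?_, ?_, fun c hc => ?_⟩
  · rw [List.mem_reverse, List.mem_map] at hl
    obtain ⟨l, hl, rfl⟩ := hl
    exact h1 l hl
  · clear h1 h3
    induction ω with
    | nil => simp [wordValue]
    | cons l ω ih =>
      simp only [wordValue, List.map_cons, List.reverse_cons, List.map_append, List.prod_append,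
        List.prod_cons, mul_inv_rev, List.map_nil, List.prod_nil, mul_one] at ih ⊢
      rw [ih]
      cases l.2 <;> simp
  · rw [wordDeg, List.countP_reverse, List.countP_map]
    exact h3 c hc

theorem pow_mem_wordBall {c : FormalComm k} (hc : c ∈ Γ) {r : ℝ} (hr : 1 ≤ r) {n : ℕ}
    (hn : (n : ℝ) ≤ F.fn c r) : c.eval s ^ n ∈ wordBall s F Γ 1 r := by
  classical
  refine ⟨List.replicate n (c, true), fun l hl => ?_, ?_, fun c' hc' => ?_⟩
  · rw [List.eq_of_mem_replicate hl]; exact hc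
  · simp [wordValue]
  · rw [wordDeg, List.countP_replicate, one_mul]
    by_cases h : c = c'
    · subst h; simpa using hn
    · simpa [h] using (F.fn_pos c' hr).le

theorem list_prod_mem_wordBall {K r : ℝ} (hr : 1 ≤ r) (l : List G)
    (h : ∀ g ∈ l, g ∈ wordBall s F Γ K r) : l.prod ∈ wordBall s F Γ (l.length * K) r := by
  induction l with
  | nil => exact one_mem_wordBall (by simp) hr
  | cons g l ih =>
    rw [List.prod_cons, List.length_cons]
    push_cast
    rw [add_mul, one_mul, add_comm]
    exact mul_mem_wordBall (h g List.mem_cons_self)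
      (ih fun g' hg' => h g' (List.mem_cons_of_mem _ hg'))

/-- Returning to a smaller scale needs an upper growth bound uniform over the alphabet; the
generating functions share one. -/
theorem wordBall_letters_dilation (hF : F.Doubling) {l : ℝ} (hl : 1 ≤ l) :
    ∃ C : ℝ, 1 ≤ C ∧ ∀ K r : ℝ, 0 ≤ K → 1 ≤ r →
      wordBall s F (letters k) K (l * r) ⊆ wordBall s F (letters k) (K * C) r := by
  obtain ⟨C, hC1, hC⟩ := hF.gen_dilation_le hl
  refine ⟨C, hC1, fun K r hK hr => ?_⟩
  rintro g ⟨ω, h1, h2, h3⟩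
  refine ⟨ω, h1, h2, ?_⟩
  rintro _ ⟨i, rfl⟩
  refine (h3 _ ⟨i, rfl⟩).trans ?_
  rw [mul_assoc]
  exact mul_le_mul_of_nonneg_left (hC i r hr) hK

end WordBalls

/-! ### Approximating powers of commutators modulo heavier ones. -/

section Approximation

variable {k d : ℕ} {G : Type*} [Group G] (s : Fin k → G) (w : WeightSystem k d)
  (F : WeightFunctions k) (Γ : Set (FormalComm k))

/-- The subgroup generated by the images of the formal commutators of weight larger than `v`. -/
def above (v : Lex (Fin (d + 1) → ℝ)) : Subgroup G :=
  Subgroup.closure (FormalComm.eval s '' {c | v < w.weight c})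

theorem above_level [NeZero k] (j : ℕ) : above s w (w.level j) = filtration s w (j + 1) := by
  have : {c | w.level j < w.weight c} = {c | w.level (j + 1) ≤ w.weight c} :=
    Set.ext fun c => ⟨level_le_of_lt, (level_lt_succ w j).trans_le⟩
  rw [above, filtration, this]

variable {s w} in
theorem above_normal [NeZero k] (hs : Subgroup.closure (Set.range s) = ⊤) (c : FormalComm k) :
    (above s w (w.weight c)).Normal := by
  obtain ⟨j, hj⟩ : w.weight c ∈ Set.range w.level := by rw [range_level]; exact ⟨c, rfl⟩
  rw [← hj, above_level]
  exact filtration_normal hs _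

variable {s w} in
-- The commutator of two generators is itself the image of a formal bracket of weight above `v`;
-- commutation then extends to the generated subgroups.
theorem commute_mk_above {v : Lex (Fin (d + 1) → ℝ)} [(above s w v).Normal]
    {U V : Set (FormalComm k)} (h : ∀ a ∈ U, ∀ b ∈ V, v < w.weight a + w.weight b) {x y : G}
    (hx : x ∈ Subgroup.closure (FormalComm.eval s '' U))
    (hy : y ∈ Subgroup.closure (FormalComm.eval s '' V)) :
    Commute (x : G ⧸ above s w v) (y : G ⧸ above s w v) := by
  induction hx using Subgroup.closure_induction with
  | mem x hx =>
    obtain ⟨a, ha, rfl⟩ := hx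
    induction hy using Subgroup.closure_induction with
    | mem y hy =>
      obtain ⟨b, hb, rfl⟩ := hy
      change (_ : G ⧸ above s w v) = _
      rw [← QuotientGroup.mk_mul, ← QuotientGroup.mk_mul, QuotientGroup.eq]
      refine Subgroup.subset_closure ⟨.bracket b a, ?_, ?_⟩
      · change v < w.weight b + w.weight a
        rw [add_comm (w.weight b)]
        exact h a ha b hb
      · simp [FormalComm.eval, mul_assoc]
    | one => exact Commute.one_right _
    | mul y z _ _ hy hz => exact hy.mul_right hz
    | inv y _ hy => exact hy.inv_right
  | one => exact Commute.one_left _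
  | mul y z _ _ hy hz => exact hy.mul_left hz
  | inv y _ hy => exact hy.inv_left

/-- With `c = [a, b]`, conjugation by `b` sends `a ^ p` to `a ^ p * c ^ p` and fixes powers of `c`;
iterating it `q` times gives `c ^ (p * q)`. -/
theorem bracket_pow_of_commute {H : Type*} [Group H] {a b : H}
    (ha : Commute (a⁻¹ * b⁻¹ * a * b) a) (hb : Commute (a⁻¹ * b⁻¹ * a * b) b) (p q : ℕ) :
    (a ^ p)⁻¹ * (b ^ q)⁻¹ * a ^ p * b ^ q = (a⁻¹ * b⁻¹ * a * b) ^ (p * q) := by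
  set c := a⁻¹ * b⁻¹ * a * b with hc
  have h1 : b⁻¹ * a * b = a * c := by rw [hc]; group
  have h2 : b⁻¹ * a ^ p * b = a ^ p * c ^ p := by
    rw [← ha.symm.mul_pow, ← h1]
    have := conj_pow (i := p) (a := b⁻¹) (b := a)
    simpa using this.symm
  have h3 : (b ^ q)⁻¹ * a ^ p * b ^ q = a ^ p * c ^ (p * q) := by
    induction q with
    | zero => simp
    | succ q ih =>
      have h4 : b⁻¹ * c ^ (p * q) * b = c ^ (p * q) := by
        rw [mul_assoc, (hb.pow_left (p * q)).eq, inv_mul_cancel_left]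
      calc (b ^ (q + 1))⁻¹ * a ^ p * b ^ (q + 1) = b⁻¹ * ((b ^ q)⁻¹ * a ^ p * b ^ q) * b := by
            rw [pow_succ]; group
        _ = (b⁻¹ * a ^ p * b) * (b⁻¹ * c ^ (p * q) * b) := by rw [ih]; group
        _ = a ^ p * c ^ (p * (q + 1)) := by
            rw [h2, h4, mul_assoc, ← pow_add]; congr 2; ring
  rw [mul_assoc, mul_assoc, ← mul_assoc _ (a ^ p), h3, inv_mul_cancel_left]

theorem bracket_mul_of_commute {H : Type*} [Group H] {a b x y z : H}
    (hz : z = a⁻¹ * b⁻¹ * a * b) (hxb : Commute x b) (hxy : Commute x y) (hya : Commute y a)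
    (hzx : Commute z x) (hzy : Commute z y) :
    (a * x)⁻¹ * (b * y)⁻¹ * (a * x) * (b * y) = z := by
  calc (a * x)⁻¹ * (b * y)⁻¹ * (a * x) * (b * y)
      = x⁻¹ * (a⁻¹ * y⁻¹) * b⁻¹ * a * (x * (b * y)) := by group
    _ = x⁻¹ * (y⁻¹ * a⁻¹) * b⁻¹ * a * ((b * y) * x) := by
        rw [(hxb.mul_right hxy).eq, (hya.inv_inv).eq]
    _ = x⁻¹ * (y⁻¹ * (z * y)) * x := by rw [hz]; group
    _ = z := by rw [hzy.eq, inv_mul_cancel_left, mul_assoc, hzx.eq, inv_mul_cancel_left]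

/-- All powers `c ^ n` with `n ≤ F_c(r)` are, modulo heavier commutators, represented by words over
`Γ` that are short at scale `r`. -/
def Approximable (c : FormalComm k) : Prop :=
  ∃ K : ℝ, 0 ≤ K ∧ ∀ r : ℝ, 1 ≤ r → ∀ n : ℕ, (n : ℝ) ≤ F.fn c r →
    ∃ g ∈ wordBall s F Γ K r, (c.eval s ^ n)⁻¹ * g ∈ above s w (w.weight c)

variable {s F Γ}

theorem approximable_of_mem {c : FormalComm k} (hc : c ∈ Γ) : Approximable s w F Γ c :=
  ⟨1, zero_le_one, fun r hr n hn => ⟨_, pow_mem_wordBall hc hr hn, by simp⟩⟩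

/-- Modulo weight above `w(a) + w(b)`, the bracket of `a` and `b` is central. The error of `A`
commutes with `b`, that of `B` with `a`, and the two errors with each other, so neither affects the
commutator. -/
theorem bracket_approx [NeZero k] (hs : Subgroup.closure (Set.range s) = ⊤)
    {a b : FormalComm k} {p q : ℕ} {A B : G}
    (hA : (a.eval s ^ p)⁻¹ * A ∈ above s w (w.weight a))
    (hB : (b.eval s ^ q)⁻¹ * B ∈ above s w (w.weight b)) :
    ((FormalComm.bracket a b).eval s ^ (p * q))⁻¹ * (A⁻¹ * B⁻¹ * A * B) ∈
      above s w (w.weight (.bracket a b)) := by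
  set N := above s w (w.weight (.bracket a b)) with hN
  have hnorm : N.Normal := above_normal hs _
  obtain ⟨x, hx, rfl⟩ : ∃ x, x ∈ above s w (w.weight a) ∧ A = a.eval s ^ p * x :=
    ⟨_, hA, by group⟩
  obtain ⟨y, hy, rfl⟩ : ∃ y, y ∈ above s w (w.weight b) ∧ B = b.eval s ^ q * y :=
    ⟨_, hB, by group⟩
  have single : ∀ c : FormalComm k, c.eval s ∈ Subgroup.closure (FormalComm.eval s '' {c}) :=
    fun c => Subgroup.subset_closure ⟨c, rfl, rfl⟩
  have hw : w.weight (.bracket a b) = w.weight a + w.weight b := rfl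
  have hpos : ∀ c : FormalComm k, 0 < w.weight c := fun c => lex_pos (weight_pos w c)
  set c := FormalComm.bracket a b with hc
  have hcU : ∀ (V : Set (FormalComm k)), ∀ y ∈ Subgroup.closure (FormalComm.eval s '' V),
      Commute ((c.eval s : G) : G ⧸ N) (y : G ⧸ N) := by
    intro V y hy
    refine commute_mk_above (U := {c}) (V := V) ?_ (single c) hy
    rintro _ rfl e -
    exact lt_add_of_pos_right _ (hpos e)
  have hxb : Commute (x : G ⧸ N) ((b.eval s : G) : G ⧸ N) := by
    refine commute_mk_above (V := {b}) ?_ hx (single b)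
    rintro e he _ rfl
    exact add_lt_add_left he _
  have hya : Commute (y : G ⧸ N) ((a.eval s : G) : G ⧸ N) := by
    refine commute_mk_above (V := {a}) ?_ hy (single a)
    rintro e he _ rfl
    rw [hw, add_comm (w.weight _) (w.weight b)]
    exact add_lt_add_left he _
  have hxy : Commute (x : G ⧸ N) (y : G ⧸ N) := by
    refine commute_mk_above ?_ hx hy
    intro e he e' he'
    exact add_lt_add he he'
  have hce : ((c.eval s : G) : G ⧸ N) = ((a.eval s : G) : G ⧸ N)⁻¹ * ((b.eval s : G) : G ⧸ N)⁻¹ * ((a.eval s : G) : G ⧸ N) *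
      ((b.eval s : G) : G ⧸ N) := rfl
  have hz : ((c.eval s : G) : G ⧸ N) ^ (p * q) = (((a.eval s : G) : G ⧸ N) ^ p)⁻¹ * (((b.eval s : G) : G ⧸ N) ^ q)⁻¹ *
      ((a.eval s : G) : G ⧸ N) ^ p * ((b.eval s : G) : G ⧸ N) ^ q := by
    rw [bracket_pow_of_commute, ← hce]
    · rw [← hce]; exact hcU _ _ (single a)
    · rw [← hce]; exact hcU _ _ (single b)
  have hfinal := bracket_mul_of_commute hz (hxb.pow_right q) hxy (hya.pow_right p)
    ((hcU _ _ hx).pow_left _) ((hcU _ _ hy).pow_left _)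
  rw [← QuotientGroup.eq]
  exact hfinal.symm

/-- For a bracket, put `α = ⌊F_a(r)⌋` and use `[a,b] ^ n = [a ^ α, b ^ (n / α)] * [a ^ (n % α), b]`
modulo heavier terms. All exponents are admissible at a scale `l * r`, where the induction
hypothesis applies; the resulting words are then brought back to scale `r`. -/
theorem approximable_letters [NeZero k] (hs : Subgroup.closure (Set.range s) = ⊤)
    (hF : F.Doubling) (c : FormalComm k) : Approximable s w F (letters k) c := by
  induction c with
  | letter i b =>
    have h : FormalComm.letter i true ∈ letters k := ⟨i, rfl⟩
    cases b
    · refine ⟨1, zero_le_one, fun r hr n hn => ⟨_, inv_mem_wordBall (pow_mem_wordBall h hr hn), ?_⟩⟩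
      simp [FormalComm.eval]
    · exact approximable_of_mem w h
  | bracket a b ha hb =>
    obtain ⟨Ka, hKa, ha⟩ := ha
    obtain ⟨Kb, hKb, hb⟩ := hb
    obtain ⟨l, hl, hdil⟩ := hF.exists_dilation 2
    obtain ⟨C, hC1, hC⟩ := wordBall_letters_dilation (s := s) hF hl
    -- Two group commutators of four factors each; `C` is the price of going from `l * r` back to
    -- `r`.
    refine ⟨((Ka + Kb + Ka + Kb) + (Ka + Kb + Ka + Kb)) * C, by positivity, fun r hr n hn => ?_⟩
    have hlr : 1 ≤ l * r := one_le_mul_of_one_le_of_one_le hl hr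
    have hmono : ∀ c, F.fn c r ≤ F.fn c (l * r) := fun c =>
      F.fn_mono c hr hlr (le_mul_of_one_le_left (by linarith) hl)
    set α := ⌊F.fn a r⌋₊ with hα
    have hα1 : 1 ≤ α := Nat.le_floor (by simpa using F.one_le_fn a hr)
    have hαF : (α : ℝ) ≤ F.fn a r := Nat.floor_le (F.fn_pos a hr).le
    have hFα : F.fn a r ≤ 2 * α := by
      have h1 := (Nat.lt_floor_add_one (F.fn a r)).le
      have h2 : (1 : ℝ) ≤ α := by exact_mod_cast hα1
      rw [← hα] at h1
      linarith
    -- Since `n ≤ F_a(r) F_b(r)` and `F_a(r) ≤ 2 α`, the quotient is at most `2 F_b(r)`; `l` was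
    -- chosen to absorb this factor 2.
    have hqF : ((n / α : ℕ) : ℝ) ≤ F.fn b (l * r) := by
      refine le_trans ?_ (hdil b r hr)
      have hα0 : (0 : ℝ) < α := by exact_mod_cast hα1
      refine (Nat.cast_div_le).trans ?_
      rw [div_le_iff₀ hα0]
      have hn' : (n : ℝ) ≤ F.fn a r * F.fn b r := hn
      have := mul_le_mul_of_nonneg_right hFα (F.fn_pos b hr).le
      linarith
    obtain ⟨A₁, hA₁, hA₁'⟩ := ha (l * r) hlr α (hαF.trans (hmono a))
    obtain ⟨B₁, hB₁, hB₁'⟩ := hb (l * r) hlr (n / α) hqF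
    have hρ : ((n % α : ℕ) : ℝ) ≤ F.fn a (l * r) := by
      have : ((n % α : ℕ) : ℝ) ≤ α := by exact_mod_cast (Nat.mod_lt n hα1).le
      exact this.trans (hαF.trans (hmono a))
    obtain ⟨A₂, hA₂, hA₂'⟩ := ha (l * r) hlr (n % α) hρ
    obtain ⟨B₂, hB₂, hB₂'⟩ := hb (l * r) hlr 1 (by simpa using F.one_le_fn b hlr)
    have hcomm : ∀ {A B : G}, A ∈ wordBall s F (letters k) Ka (l * r) →
        B ∈ wordBall s F (letters k) Kb (l * r) →
        A⁻¹ * B⁻¹ * A * B ∈ wordBall s F (letters k) (Ka + Kb + Ka + Kb) (l * r) :=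
      fun hA hB => mul_mem_wordBall (mul_mem_wordBall (mul_mem_wordBall (inv_mem_wordBall hA)
        (inv_mem_wordBall hB)) hA) hB
    refine ⟨_, hC _ r (by positivity) hr
      (mul_mem_wordBall (hcomm hA₁ hB₁) (hcomm hA₂ hB₂)), ?_⟩
    have e1 := bracket_approx w hs hA₁' hB₁'
    have e2 := bracket_approx w hs hA₂' hB₂'
    have hnorm := above_normal (w := w) hs (.bracket a b)
    rw [← QuotientGroup.eq] at e1 e2 ⊢
    rw [QuotientGroup.mk_mul _ (A₁⁻¹ * B₁⁻¹ * A₁ * B₁), ← e1, ← e2, ← QuotientGroup.mk_mul,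
      ← pow_add, mul_one, Nat.div_add_mod]

end Approximation

/-! ### Lower bound for one layer. -/

section LowerBound

variable {k d : ℕ} {G : Type*} [Group G] (s : Fin k → G) (w : WeightSystem k d)
  (F : WeightFunctions k) (Γ : Set (FormalComm k))

/-- At each scale `r`, at least `φ(r)` elements of the `j`-th term of the filtration are represented
by short words over `Γ`. -/
def ManyShort (j : ℕ) (φ : ℝ → ℝ) : Prop :=
  ∃ K : ℝ, 0 ≤ K ∧ ∀ r : ℝ, 1 ≤ r → ∃ Y : Finset G,
    (∀ y ∈ Y, y ∈ filtration s w j ∧ y ∈ wordBall s F Γ K r) ∧ φ r ≤ Y.card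

variable {s w F Γ}

theorem manyShort_one (j : ℕ) : ManyShort s w F Γ j fun _ => 1 :=
  ⟨0, le_rfl, fun r hr => ⟨{1}, fun y hy => by
    rw [Finset.mem_singleton.mp hy]
    exact ⟨one_mem _, one_mem_wordBall le_rfl hr⟩, by simp⟩⟩

/-- Exponent vectors in a box give short products `X n` whose classes are distinct combinations of
an independent family. Multiplying by elements of the next term preserves the classes, so the counts
multiply. -/
theorem manyShort_step [NeZero k] {j : ℕ} {b : Fin (gradedRank s w j) → FormalComm k}
    (hb : ∀ i, w.weight (b i) = w.level j)
    (hind : LinearIndependent ℤ fun i => gradedClass s w (hb i))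
    (happ : ∀ i, Approximable s w F Γ (b i)) {φ : ℝ → ℝ}
    (h : ManyShort s w F Γ (j + 1) φ) :
    ManyShort s w F Γ j fun r => (∏ i, F.fn (b i) r) * φ r := by
  classical
  obtain ⟨K, hK0, hK⟩ := h
  choose L hL0 hL using happ
  refine ⟨gradedRank s w j * (∑ i, L i) + K, add_nonneg (mul_nonneg (Nat.cast_nonneg _)
    (Finset.sum_nonneg fun i _ => hL0 i)) hK0, fun r hr => ?_⟩
  obtain ⟨Y, hY, hφY⟩ := hK r hr
  -- The bound on `n` is put inside the existential so that `g` is a total function; out of range it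
  -- is the junk value `1`.
  have hex : ∀ (i : Fin (gradedRank s w j)) (n : ℕ), ∃ g : filtration s w j, (n : ℝ) ≤ F.fn (b i) r →
      (g : G) ∈ wordBall s F Γ (L i) r ∧
        Additive.ofMul (QuotientGroup.mk g : Graded s w j) = n • gradedClass s w (hb i) := by
    intro i n
    by_cases hn : (n : ℝ) ≤ F.fn (b i) r
    · obtain ⟨g, hg, hg'⟩ := hL i r hr n hn
      rw [hb i, above_level] at hg'
      have hbm := eval_mem_filtration s w (hb i).ge
      have hgj : g ∈ filtration s w j := by
        have := mul_mem (pow_mem hbm n) (filtration_succ_le j hg')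
        simpa using this
      refine ⟨⟨g, hgj⟩, fun _ => ⟨hg, ?_⟩⟩
      have : (QuotientGroup.mk (⟨_, hbm⟩ ^ n) : Graded s w j) = QuotientGroup.mk ⟨g, hgj⟩ := by
        rw [QuotientGroup.eq, Subgroup.mem_subgroupOf]
        exact hg'
      exact congrArg Additive.ofMul this.symm
    · exact ⟨1, fun h => absurd h hn⟩
  choose g hg using hex
  let X : (Fin (gradedRank s w j) → ℕ) → filtration s w j := fun n => (List.ofFn fun i => g i (n i)).prod
  let I : Finset (Fin (gradedRank s w j) → ℕ) := Fintype.piFinset fun i => Finset.range (⌊F.fn (b i) r⌋₊ + 1)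
  have hI : ∀ n ∈ I, ∀ i, (n i : ℝ) ≤ F.fn (b i) r := by
    intro n hn i
    have := Finset.mem_range_succ_iff.mp (Fintype.mem_piFinset.mp hn i)
    exact (Nat.le_floor_iff (F.fn_pos _ hr).le).mp this
  have hX : ∀ n ∈ I, Additive.ofMul (QuotientGroup.mk (X n) : Graded s w j) =
      ∑ i, n i • gradedClass s w (hb i) := by
    intro n hn
    have h1 : (QuotientGroup.mk (X n) : Graded s w j) =
        (List.ofFn fun i => (QuotientGroup.mk (g i (n i)) : Graded s w j)).prod := by
      have := map_list_prod (QuotientGroup.mk' ((filtration s w (j + 1)).subgroupOf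
        (filtration s w j))) (List.ofFn fun i => g i (n i))
      rw [List.map_ofFn] at this
      exact this
    rw [h1, List.prod_ofFn, ofMul_prod]
    exact Finset.sum_congr rfl fun i _ => (hg i (n i) (hI n hn i)).2
  have hXball : ∀ n ∈ I, (X n : G) ∈ wordBall s F Γ (gradedRank s w j * ∑ i, L i) r := by
    intro n hn
    have h1 : (X n : G) = (List.ofFn fun i => (g i (n i) : G)).prod := by
      have := map_list_prod (filtration s w j).subtype (List.ofFn fun i => g i (n i))
      rw [List.map_ofFn] at this
      exact this
    have h2 := list_prod_mem_wordBall (s := s) (F := F) (Γ := Γ) (K := ∑ i, L i) hr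
      (List.ofFn fun i => (g i (n i) : G)) ?_
    · rwa [List.length_ofFn, ← h1] at h2
    · intro x hx
      obtain ⟨i, rfl⟩ := (List.mem_ofFn' _ _).mp hx
      exact wordBall_mono hr (Finset.single_le_sum (fun i _ => hL0 i) (Finset.mem_univ i))
        (hg i (n i) (hI n hn i)).1
  -- The class in the layer determines `n` by independence; cancelling `X n` then determines `y`.
  have hinj : Set.InjOn (fun p : (Fin (gradedRank s w j) → ℕ) × G => (X p.1 : G) * p.2) (I ×ˢ Y : Finset _) := by
    rintro ⟨n, y⟩ hny ⟨m, z⟩ hmz heq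
    simp only [Finset.coe_product, Set.mem_prod, Finset.mem_coe] at hny hmz heq
    have hmem : (X n : G)⁻¹ * X m ∈ filtration s w (j + 1) := by
      have h1 : (X n : G)⁻¹ * X m = y * z⁻¹ := by
        rw [inv_mul_eq_iff_eq_mul, ← mul_assoc, heq, mul_inv_cancel_right]
      rw [h1]
      exact mul_mem (hY y hny.2).1 (inv_mem (hY z hmz.2).1)
    have hq : (QuotientGroup.mk (X n) : Graded s w j) = QuotientGroup.mk (X m) := by
      rw [QuotientGroup.eq, Subgroup.mem_subgroupOf]
      exact hmem
    have hsum : ∑ i, ((n i : ℤ) - m i) • gradedClass s w (hb i) = 0 := by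
      simp only [sub_smul, natCast_zsmul, Finset.sum_sub_distrib]
      rw [← hX n hny.1, ← hX m hmz.1, hq, sub_self]
    have hnm : n = m := by
      funext i
      have := Fintype.linearIndependent_iff.mp hind (fun i => (n i : ℤ) - m i) hsum i
      omega
    subst hnm
    simpa using heq
  refine ⟨(I ×ˢ Y).image fun p => (X p.1 : G) * p.2, ?_, ?_⟩
  · intro x hx
    obtain ⟨⟨n, y⟩, hny, rfl⟩ := Finset.mem_image.mp hx
    rw [Finset.mem_product] at hny
    exact ⟨mul_mem (X n).2 (filtration_succ_le j (hY y hny.2).1),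
      mul_mem_wordBall (hXball n hny.1) (hY y hny.2).2⟩
  · rw [Finset.card_image_of_injOn hinj, Finset.card_product, Fintype.card_piFinset]
    push_cast
    have h1 : ∏ i, F.fn (b i) r ≤
        ∏ i, (((Finset.range (⌊F.fn (b i) r⌋₊ + 1)).card : ℕ) : ℝ) := by
      refine Finset.prod_le_prod (fun i _ => (F.fn_pos _ hr).le) fun i _ => ?_
      rw [Finset.card_range]
      push_cast
      exact (Nat.lt_floor_add_one _).le
    refine (mul_le_mul_of_nonneg_left hφY
      (Finset.prod_nonneg fun i _ => (F.fn_pos _ hr).le)).trans ?_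
    exact mul_le_mul_of_nonneg_right h1 (Nat.cast_nonneg _)

end LowerBound

/-! ### Quasi-norm balls against word balls and cost balls. -/

section Balls

variable {k d : ℕ} {G : Type*} [Group G] {s : Fin k → G} {w : WeightSystem k d}
  {F : WeightFunctions k} {Γ : Set (FormalComm k)}

theorem genInv_nonempty (hF : F.Doubling) (c₀ : FormalComm k) (y : ℝ) :
    {r : ℝ | 1 ≤ r ∧ y ≤ F.fn c₀ r}.Nonempty := by
  obtain ⟨l, hl, h⟩ := hF.exists_dilation |y|
  refine ⟨l, hl, (le_abs_self y).trans ?_⟩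
  have h1 := h c₀ 1 le_rfl
  rw [mul_one] at h1
  exact (le_mul_of_one_le_right (abs_nonneg y) (F.one_le_fn c₀ le_rfl)).trans h1

theorem genInv_le (c₀ : FormalComm k) {y r : ℝ} (hr : 1 ≤ r) (h : y ≤ F.fn c₀ r) :
    genInv (F.fn c₀) y ≤ r :=
  csInf_le ⟨1, fun _ hx => hx.1⟩ ⟨hr, h⟩

theorem one_le_genInv (hF : F.Doubling) (c₀ : FormalComm k) (y : ℝ) :
    1 ≤ genInv (F.fn c₀) y :=
  le_csInf (genInv_nonempty hF c₀ y) fun _ hx => hx.1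

/-- The factor 2 is needed because `F_{c₀}` may be constant on intervals, where the inverse of
`F_{c₀}(r)` falls below `r`. -/
theorem le_genInv (hF : F.Doubling) (c₀ : FormalComm k) {r : ℝ} (hr : 1 ≤ r) :
    r ≤ genInv (F.fn c₀) (2 * F.fn c₀ r) := by
  refine le_csInf (genInv_nonempty hF c₀ _) fun x hx => ?_
  by_contra! hlt
  have h1 := F.fn_mono c₀ hx.1 hr hlt.le
  have h2 := F.fn_pos c₀ hr
  linarith [hx.2]

theorem mem_quasiNorm_set (hF : F.Doubling) (c₀ : FormalComm k) {r : ℝ} (hr : 1 ≤ r) {g : G}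
    (hg : g ∈ wordBall s F Γ 1 r) :
    2 * F.fn c₀ r ∈ {ρ : ℝ | 1 ≤ ρ ∧ ∃ ω : List (FormalComm k × Bool), (∀ l ∈ ω, l.1 ∈ Γ) ∧
      wordValue s ω = g ∧ ∀ c ∈ Γ, (wordDeg c ω : ℝ) ≤ F.fn c (genInv (F.fn c₀) ρ)} := by
  obtain ⟨ω, h1, h2, h3⟩ := hg
  have hle := le_genInv hF c₀ hr
  refine ⟨by linarith [F.one_le_fn c₀ hr], ω, h1, h2, fun c hc => ?_⟩
  have := h3 c hc
  rw [one_mul] at this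
  exact this.trans (F.fn_mono c hr (hr.trans hle) hle)

theorem wordBall_dilation (hF : F.Doubling) (K : ℝ) :
    ∃ l : ℝ, 1 ≤ l ∧ ∀ r : ℝ, 1 ≤ r → wordBall s F Γ K r ⊆ wordBall s F Γ 1 (l * r) := by
  obtain ⟨l, hl, h⟩ := hF.exists_dilation K
  refine ⟨l, hl, fun r hr => ?_⟩
  rintro g ⟨ω, h1, h2, h3⟩
  exact ⟨ω, h1, h2, fun c hc => by rw [one_mul]; exact (h3 c hc).trans (h c r hr)⟩

theorem one_mem_ball (c₀ : FormalComm k) {r : ℝ} (hr : 1 ≤ r) : (1 : G) ∈ ball s F Γ c₀ r := by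
  change genInv _ (quasiNorm s F Γ c₀ 1) ≤ r
  rw [quasiNorm, if_pos rfl]
  exact genInv_le c₀ hr (F.fn_pos c₀ hr).le

theorem wordBall_subset_ball (hF : F.Doubling) (c₀ : FormalComm k) (K : ℝ) :
    ∃ l : ℝ, 1 ≤ l ∧ ∀ r : ℝ, 1 ≤ r → wordBall s F Γ K r ⊆ ball s F Γ c₀ (l * r) := by
  obtain ⟨l, hl, h⟩ := wordBall_dilation (s := s) (Γ := Γ) hF K
  obtain ⟨C, hC1, hC⟩ := hF.exists_dilation 2
  refine ⟨C * l, one_le_mul_of_one_le_of_one_le hC1 hl, fun r hr g hg => ?_⟩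
  have hlr : 1 ≤ l * r := one_le_mul_of_one_le_of_one_le hl hr
  have hClr : 1 ≤ C * l * r := by
    rw [mul_assoc]; exact one_le_mul_of_one_le_of_one_le hC1 hlr
  by_cases hg1 : g = 1
  · rw [hg1]; exact one_mem_ball c₀ hClr
  · change genInv _ (quasiNorm s F Γ c₀ g) ≤ _
    refine genInv_le c₀ hClr ?_
    rw [quasiNorm, if_neg hg1, mul_assoc]
    exact (csInf_le ⟨1, fun _ hx => hx.1⟩ (mem_quasiNorm_set hF c₀ hlr (h r hr hg))).trans
      (hC c₀ _ hlr)

theorem exists_word_of_mem_closure {g : G}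
    (hg : g ∈ Subgroup.closure (FormalComm.eval s '' Γ)) :
    ∃ ω : List (FormalComm k × Bool), (∀ l ∈ ω, l.1 ∈ Γ) ∧ wordValue s ω = g := by
  obtain ⟨u, hu, rfl⟩ := exists_listValue_of_mem_closure hg
  clear hg
  induction u with
  | nil => exact ⟨[], by simp, rfl⟩
  | cons c u ih =>
    obtain ⟨ω, h1, h2⟩ := ih fun c' hc' => hu c' (List.mem_cons_of_mem _ hc')
    have hcons : ∀ p : FormalComm k × Bool, p.1 ∈ Γ → ∀ l ∈ p :: ω, l.1 ∈ Γ :=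
      fun p hp l hl => (List.mem_cons.mp hl).elim (fun h => h ▸ hp) (h1 l)
    rcases hu c List.mem_cons_self with h | h
    · refine ⟨(c, true) :: ω, hcons _ h, ?_⟩
      rw [listValue_cons, ← h2]
      simp [wordValue]
    · refine ⟨(c.inv, false) :: ω, hcons _ h, ?_⟩
      rw [listValue_cons, ← h2]
      simp [wordValue, FormalComm.eval_inv]

/-- Neither the infimum in the inverse function nor the one in the quasi-norm need be attained. Each
is passed at the price of a factor 2, the first in the radius and the second in `ρ`, where `C` turns
it into a dilation. -/
theorem ball_subset_wordBall (hF : F.Doubling) (c₀ : FormalComm k)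
    (hΓ : Subgroup.closure (FormalComm.eval s '' Γ) = ⊤) :
    ∃ l : ℝ, 1 ≤ l ∧ ∀ r : ℝ, 1 ≤ r → ball s F Γ c₀ r ⊆ wordBall s F Γ 1 (l * r) := by
  obtain ⟨C, hC1, hC⟩ := hF.exists_dilation 2
  refine ⟨C * 2, by linarith, fun r hr g hg => ?_⟩
  have h2r : 1 ≤ 2 * r := by linarith
  have hCr : 1 ≤ C * (2 * r) := one_le_mul_of_one_le_of_one_le hC1 h2r
  rw [mul_assoc]
  by_cases hg1 : g = 1
  · rw [hg1]; exact one_mem_wordBall zero_le_one hCr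
  change genInv _ (quasiNorm s F Γ c₀ g) ≤ r at hg
  rw [quasiNorm, if_neg hg1] at hg
  set S := {ρ : ℝ | 1 ≤ ρ ∧ ∃ ω : List (FormalComm k × Bool), (∀ l ∈ ω, l.1 ∈ Γ) ∧
      wordValue s ω = g ∧ ∀ c ∈ Γ, (wordDeg c ω : ℝ) ≤ F.fn c (genInv (F.fn c₀) ρ)} with hS
  -- Generation enters here: if `S` were empty its infimum would be the default `0`, and `g` would
  -- lie in every ball.
  have hne : S.Nonempty := by
    obtain ⟨ω, h1, h2⟩ := exists_word_of_mem_closure (hΓ ▸ Subgroup.mem_top g)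
    obtain ⟨l, hl, h⟩ := wordBall_dilation (s := s) (Γ := Γ) hF ω.length
    refine ⟨_, mem_quasiNorm_set hF c₀ (by linarith : 1 ≤ l * 1)
      (h 1 le_rfl ⟨ω, h1, h2, fun c _ => ?_⟩)⟩
    have hdeg : (wordDeg c ω : ℝ) ≤ ω.length := by exact_mod_cast List.countP_le_length
    exact hdeg.trans (le_mul_of_one_le_right (Nat.cast_nonneg _) (F.one_le_fn c le_rfl))
  have hν1 : 1 ≤ sInf S := le_csInf hne fun _ hx => hx.1
  obtain ⟨r', hr', hlt⟩ := exists_lt_of_csInf_lt (genInv_nonempty hF c₀ (sInf S))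
    (lt_of_le_of_lt hg (by linarith : r < 2 * r))
  have hν : sInf S ≤ F.fn c₀ (2 * r) := hr'.2.trans (F.fn_mono c₀ hr'.1 h2r hlt.le)
  obtain ⟨ρ, ⟨-, ω, h1, h2, h3⟩, hρ⟩ := exists_lt_of_csInf_lt hne
    (by linarith : sInf S < 2 * sInf S)
  have hle : genInv (F.fn c₀) ρ ≤ C * (2 * r) :=
    genInv_le c₀ hCr (by linarith [hC c₀ (2 * r) h2r])
  exact ⟨ω, h1, h2, fun c hc => by
    rw [one_mul]
    exact (h3 c hc).trans (F.fn_mono c (one_le_genInv hF c₀ ρ) hCr hle)⟩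

theorem wordDeg_cons (c : FormalComm k) (l : FormalComm k × Bool)
    (ω : List (FormalComm k × Bool)) [Decidable (l.1 = c)] :
    wordDeg c (l :: ω) = wordDeg c ω + if l.1 = c then 1 else 0 := by
  rw [wordDeg, List.countP_cons, wordDeg]
  congr 1
  by_cases h : l.1 = c <;> simp [h]

theorem exists_listValue_eq_wordValue (T : Finset (FormalComm k))
    (hT : ∀ c ∉ T, c.eval s = 1) {r : ℝ} (ω : List (FormalComm k × Bool)) :
    ∃ u : List (FormalComm k), listValue s u = wordValue s ω ∧
      cost F r u = ∑ c ∈ T, wordDeg c ω * (F.fn c r)⁻¹ := by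
  classical
  induction ω with
  | nil => exact ⟨[], rfl, by simp [wordDeg]⟩
  | cons l ω ih =>
    obtain ⟨u, hu, hcost⟩ := ih
    have hval : wordValue s (l :: ω) =
        (if l.2 then l.1.eval s else (l.1.eval s)⁻¹) * wordValue s ω := by
      simp [wordValue]
    have hsum : ∑ c ∈ T, (wordDeg c (l :: ω) : ℝ) * (F.fn c r)⁻¹ =
        (∑ c ∈ T, (wordDeg c ω : ℝ) * (F.fn c r)⁻¹) + if l.1 ∈ T then (F.fn l.1 r)⁻¹ else 0 := by
      simp only [wordDeg_cons, Nat.cast_add, add_mul, Finset.sum_add_distrib, Nat.cast_ite,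
        Nat.cast_one, Nat.cast_zero, ite_mul, one_mul, zero_mul, Finset.sum_ite_eq]
    rw [hval, hsum]
    by_cases hl : l.1 ∈ T
    · rw [if_pos hl]
      cases l.2
      · refine ⟨l.1.inv :: u, by simp [FormalComm.eval_inv, hu], ?_⟩
        rw [cost_cons, hcost, FormalComm.fn_inv, add_comm]
      · exact ⟨l.1 :: u, by simp [hu], by rw [cost_cons, hcost, add_comm]⟩
    · exact ⟨u, by simp [hT _ hl, hu], by rw [if_neg hl, add_zero, hcost]⟩

/-- Letters outside `T` can be erased, and all occurrences of one letter of `T` cost at most `1`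
together. The bound is thus independent of the size of `Γ`. -/
theorem wordBall_subset_costBall (T : Finset (FormalComm k)) (hT : ∀ c ∉ T, c.eval s = 1)
    {r : ℝ} (hr : 1 ≤ r) : wordBall s F Γ 1 r ⊆ costBall s F Set.univ T.card r := by
  classical
  rintro g ⟨ω, h1, h2, h3⟩
  obtain ⟨u, hu, hcost⟩ := exists_listValue_eq_wordValue (F := F) (r := r) T hT ω
  refine ⟨u, fun _ _ => Set.mem_univ _, hu.trans h2, ?_⟩
  rw [hcost, Finset.card_eq_sum_ones]
  push_cast
  refine Finset.sum_le_sum fun c _ => ?_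
  rw [← div_eq_mul_inv, div_le_one (F.fn_pos c hr)]
  by_cases hc : c ∈ Γ
  · simpa using h3 c hc
  · have : wordDeg c ω = 0 := by
      rw [wordDeg, List.countP_eq_zero]
      intro l hl
      simpa using fun h : l.1 = c => hc (h ▸ h1 l hl)
    rw [this, Nat.cast_zero]
    exact (F.fn_pos c hr).le

end Balls

/-! ### The filtration of a nilpotent group terminates. -/

section Filtration

variable {k d : ℕ} {G : Type*} [Group G] {s : Fin k → G} {w : WeightSystem k d}

theorem closure_eval_letters : Subgroup.closure (FormalComm.eval s '' letters k) =
    Subgroup.closure (Set.range s) := by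
  rw [letters, ← Set.range_comp]
  rfl

theorem filtration_zero [NeZero k] (hs : Subgroup.closure (Set.range s) = ⊤) :
    filtration s w 0 = ⊤ := by
  rw [eq_top_iff, ← hs, Subgroup.closure_le]
  rintro _ ⟨i, rfl⟩
  exact eval_mem_filtration s w (c := .letter i true) ((isLeast_level_zero w).2 ⟨_, rfl⟩)

theorem filtration_antitone [NeZero k] : Antitone (filtration s w) :=
  antitone_nat_of_succ_le filtration_succ_le

theorem filtration_le_sup (j : ℕ) :
    filtration s w j ≤ Subgroup.closure (FormalComm.eval s '' {c | w.weight c = w.level j}) ⊔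
      filtration s w (j + 1) := by
  refine (Subgroup.closure_le _).mpr ?_
  rintro _ ⟨c, hc, rfl⟩
  rcases (show w.level j ≤ w.weight c from hc).eq_or_lt with h | h
  · exact Subgroup.mem_sup_left (Subgroup.subset_closure ⟨c, h.symm, rfl⟩)
  · exact Subgroup.mem_sup_right (eval_mem_filtration s w (level_le_of_lt h))

/-- One of the two entries of a bracket has at least half of its letters, so each doubling of the
length gains one step. -/
theorem eval_mem_lowerCentralSeries (n : ℕ) (c : FormalComm k) (hc : 2 ^ n ≤ c.length) :
    c.eval s ∈ (⊤ : Subgroup G).lowerCentralSeries n := by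
  induction n generalizing c with
  | zero => exact Subgroup.mem_top _
  | succ n ih =>
    have hcomm : ∀ x ∈ (⊤ : Subgroup G).lowerCentralSeries n, ∀ y : G,
        x⁻¹ * y⁻¹ * x * y ∈ (⊤ : Subgroup G).lowerCentralSeries (n + 1) := by
      intro x hx y
      rw [Subgroup.lowerCentralSeries_succ]
      have := Subgroup.commutator_mem_commutator (inv_mem hx) (Subgroup.mem_top y⁻¹)
      simpa [commutatorElement_def] using this
    cases c with
    | letter i b =>
      have : 2 ≤ 2 ^ (n + 1) := le_self_pow (by norm_num) (by omega)
      simp only [FormalComm.length] at hc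
      omega
    | bracket a b =>
      simp only [FormalComm.length] at hc
      rw [pow_succ] at hc
      by_cases ha : 2 ^ n ≤ a.length
      · exact hcomm _ (ih a ha) _
      · have := inv_mem (hcomm _ (ih b (by omega)) (a.eval s))
        simpa [FormalComm.eval, mul_assoc] using this

theorem filtration_numSteps [Group.IsNilpotent G] [NeZero k] :
    filtration s w (numSteps s w) = ⊥ := by
  obtain ⟨n, hn⟩ := Subgroup.nilpotent_iff_lowerCentralSeries.mp ‹Group.IsNilpotent G›
  -- Short commutators take finitely many weights, whereas only finitely many levels lie below any
  -- given value; so heavy commutators are long.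
  have hex : ∃ j, ∀ c : FormalComm k, w.level j ≤ w.weight c → 2 ^ n ≤ c.length := by
    by_contra! hcon
    choose c hc hlen using hcon
    have hfin : (w.weight '' {c : FormalComm k | c.length ≤ 2 ^ n}).Finite :=
      (finite_length_le _).image _
    obtain ⟨v, hv⟩ := hfin.bddAbove
    have hall : ∀ j, w.level j ≤ v := fun j =>
      (hc j).trans (hv ⟨c j, (hlen j).le, rfl⟩)
    refine Set.infinite_range_of_injective (strictMono_level w).injective
      (((finite_weight_le w v).image w.weight).subset ?_)
    rintro _ ⟨j, rfl⟩
    obtain ⟨c', hc'⟩ := level_mem w j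
    exact ⟨c', hc'.trans_le (hall j), hc'⟩
  obtain ⟨j, hj⟩ := hex
  refine Nat.sInf_mem (s := {j | filtration s w j = ⊥}) ⟨j, ?_⟩
  rw [Set.mem_ofPred_eq, eq_bot_iff, filtration, Subgroup.closure_le]
  rintro _ ⟨c, hc, rfl⟩
  exact hn ▸ eval_mem_lowerCentralSeries n c (hj c hc)

theorem eval_eq_one [Group.IsNilpotent G] [NeZero k] {c : FormalComm k}
    (hc : w.level (numSteps s w) ≤ w.weight c) : c.eval s = 1 := by
  have := eval_mem_filtration s w hc
  rwa [filtration_numSteps, Subgroup.mem_bot] at this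

end Filtration

/-! ### Comparability and functions of controlled growth. -/

section Comparison

variable {r₀ : ℝ}

theorem ComparableFrom.symm {f g : ℝ → ℝ} (h : ComparableFrom r₀ f g) :
    ComparableFrom r₀ g f := by
  obtain ⟨C, hC, h⟩ := h
  have hpos : 0 < C := by linarith
  exact ⟨C, hC, fun r hr => ⟨(inv_mul_le_iff₀ hpos).mpr (h r hr).2,
    (inv_mul_le_iff₀ hpos).mp (h r hr).1⟩⟩

theorem ComparableFrom.trans {f g h : ℝ → ℝ} (hfg : ComparableFrom r₀ f g)
    (hgh : ComparableFrom r₀ g h) : ComparableFrom r₀ f h := by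
  obtain ⟨C, hC, hfg⟩ := hfg
  obtain ⟨D, hD, hgh⟩ := hgh
  refine ⟨C * D, one_le_mul_of_one_le_of_one_le hC hD, fun r hr => ⟨?_, ?_⟩⟩
  · rw [mul_inv, mul_assoc]
    exact (mul_le_mul_of_nonneg_left (hgh r hr).1 (by positivity)).trans (hfg r hr).1
  · rw [mul_assoc]
    exact (hfg r hr).2.trans (mul_le_mul_of_nonneg_left (hgh r hr).2 (by linarith))

theorem ComparableFrom.of_le {r₁ : ℝ} (hr : r₀ ≤ r₁) {f g : ℝ → ℝ}
    (h : ComparableFrom r₀ f g) : ComparableFrom r₁ f g := by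
  obtain ⟨C, hC, h⟩ := h
  exact ⟨C, hC, fun r hr' => h r (hr.trans hr')⟩

theorem ComparableFrom.nonneg {f g : ℝ → ℝ} (h : ComparableFrom r₀ f g)
    (hg : ∀ r, r₀ ≤ r → 0 ≤ g r) : ∀ r, r₀ ≤ r → 0 ≤ f r := by
  obtain ⟨C, hC, h⟩ := h
  exact fun r hr => (mul_nonneg (by positivity) (hg r hr)).trans (h r hr).1

theorem ComparableFrom.prod {ι : Type*} (I : Finset ι) {f g : ι → ℝ → ℝ}
    (hg : ∀ i ∈ I, ∀ r, r₀ ≤ r → 0 ≤ g i r) (h : ∀ i ∈ I, ComparableFrom r₀ (f i) (g i)) :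
    ComparableFrom r₀ (fun r => ∏ i ∈ I, f i r) fun r => ∏ i ∈ I, g i r := by
  have hf := fun i hi => (h i hi).nonneg (hg i hi)
  choose! C hC1 hC using h
  refine ⟨∏ i ∈ I, C i, Finset.prod_induction _ _ (fun _ _ => one_le_mul_of_one_le_of_one_le)
    le_rfl fun i hi => hC1 i hi, fun r hr => ⟨?_, ?_⟩⟩
  · rw [← Finset.prod_inv_distrib, ← Finset.prod_mul_distrib]
    refine Finset.prod_le_prod (fun i hi => ?_) fun i hi => (hC i hi r hr).1
    exact mul_nonneg (inv_nonneg.mpr (by linarith [hC1 i hi])) (hg i hi r hr)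
  · rw [← Finset.prod_mul_distrib]
    exact Finset.prod_le_prod (fun i hi => hf i hi r hr) fun i hi => (hC i hi r hr).2

theorem ComparableFrom.pow {f g : ℝ → ℝ} (hg : ∀ r, r₀ ≤ r → 0 ≤ g r)
    (h : ComparableFrom r₀ f g) (n : ℕ) :
    ComparableFrom r₀ (fun r => f r ^ n) fun r => g r ^ n := by
  simpa using ComparableFrom.prod (Finset.range n) (f := fun _ => f) (g := fun _ => g)
    (fun _ _ => hg) fun _ _ => h

/-- Positive non-decreasing functions of at most polynomial growth. -/
structure Tame (ψ : ℝ → ℝ) : Prop where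
  pos : ∀ r, 1 ≤ r → 0 < ψ r
  mono : MonotoneOn ψ (Set.Ici 1)
  dilation : ∀ l : ℝ, 1 ≤ l → ∃ C : ℝ, 1 ≤ C ∧ ∀ r, 1 ≤ r → ψ (l * r) ≤ C * ψ r

theorem Tame.prod {ι : Type*} (I : Finset ι) {ψ : ι → ℝ → ℝ} (h : ∀ i ∈ I, Tame (ψ i)) :
    Tame fun r => ∏ i ∈ I, ψ i r := by
  refine ⟨fun r hr => Finset.prod_pos fun i hi => (h i hi).pos r hr, fun a ha b hb hab =>
    Finset.prod_le_prod (fun i hi => ((h i hi).pos a ha).le) fun i hi => (h i hi).mono ha hb hab,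
    fun l hl => ?_⟩
  have hd := fun i hi => (h i hi).dilation l hl
  choose! C hC1 hC using hd
  refine ⟨∏ i ∈ I, C i, Finset.prod_induction _ _ (fun _ _ => one_le_mul_of_one_le_of_one_le)
    le_rfl fun i hi => hC1 i hi, fun r hr => ?_⟩
  rw [← Finset.prod_mul_distrib]
  exact Finset.prod_le_prod
    (fun i hi => ((h i hi).pos _ (one_le_mul_of_one_le_of_one_le hl hr)).le)
    fun i hi => hC i hi r hr

theorem tame_fn {k : ℕ} {F : WeightFunctions k} (hF : F.Doubling) (c : FormalComm k) :
    Tame (F.fn c) :=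
  ⟨fun _ hr => F.fn_pos c hr, F.fn_mono c, fun _ hl => hF.fn_dilation_le hl c⟩

theorem Compatible.comparable {k d : ℕ} {w : WeightSystem k d} {F : WeightFunctions k}
    (h : Compatible w F) {c c' : FormalComm k} (hc : w.weight c = w.weight c') :
    ComparableFrom 1 (F.fn c) (F.fn c') := by
  obtain ⟨C, hC1, hC⟩ := (h c c').mp hc.le
  obtain ⟨D, hD1, hD⟩ := (h c' c).mp hc.ge
  refine ⟨C * D, one_le_mul_of_one_le_of_one_le hC1 hD1, fun r hr => ⟨?_, ?_⟩⟩
  · rw [inv_mul_le_iff₀ (by positivity)]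
    refine (hD r hr).trans (mul_le_mul_of_nonneg_right ?_ (F.fn_pos c hr).le)
    exact le_mul_of_one_le_left (by linarith) hC1
  · refine (hC r hr).trans (mul_le_mul_of_nonneg_right ?_ (F.fn_pos c' hr).le)
    exact le_mul_of_one_le_right (by linarith) hD1

end Comparison

/-! ### Ball volumes for the three alphabets. -/

section Volume

variable {k d : ℕ} {G : Type*} [Group G] [Group.IsNilpotent G] [NeZero k] {s : Fin k → G}
  {w : WeightSystem k d} {F : WeightFunctions k}

/-- The volume of the balls of an alphabet for which sufficiently many commutators are
approximable. -/
theorem ball_volume (hF : F.Doubling)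
    (hwF : Compatible w F) (Γ : Set (FormalComm k)) (c₀ : FormalComm k)
    (hΓ : Subgroup.closure (FormalComm.eval s '' Γ) = ⊤)
    (happ : ∀ j < numSteps s w, ∃ A : Set (FormalComm k), (∀ c ∈ A, w.weight c = w.level j) ∧
      filtration s w j ≤ Subgroup.closure (FormalComm.eval s '' A) ⊔ filtration s w (j + 1) ∧
      ∀ c ∈ A, Approximable s w F Γ c)
    (e : ℕ → FormalComm k) (he : ∀ j, w.weight (e j) = w.level j) :
    (∀ r : ℝ, 1 ≤ r → (ball s F Γ c₀ r).Finite) ∧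
      ComparableFrom 1 (fun r => ((ball s F Γ c₀ r).ncard : ℝ))
        fun r => ∏ j ∈ Finset.range (numSteps s w), F.fn (e j) r ^ gradedRank s w j := by
  set J := numSteps s w with hJ
  have hbot : filtration s w J = ⊥ := filtration_numSteps
  have happ' : ∀ j, ∃ (b : Fin (gradedRank s w j) → FormalComm k)
      (hb : ∀ i, w.weight (b i) = w.level j),
      (∀ i, Approximable s w F Γ (b i)) ∧ (LinearIndependent ℤ fun i => gradedClass s w (hb i)) ∧
      ∀ c, w.weight c = w.level j → ∃ q : ℕ, 0 < q ∧
        c.eval s ^ q ∈ Subgroup.closure (FormalComm.eval s '' Set.range b) ⊔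
          filtration s w (j + 1) := by
    intro j
    obtain ⟨A, hA, hgen, hap⟩ : ∃ A : Set (FormalComm k), (∀ c ∈ A, w.weight c = w.level j) ∧
        filtration s w j ≤ Subgroup.closure (FormalComm.eval s '' A) ⊔ filtration s w (j + 1) ∧
        ∀ c ∈ A, Approximable s w F Γ c := by
      rcases lt_or_ge j J with h | h
      · exact happ j h
      -- Beyond the last step the filtration is trivial and the empty set serves; this makes the
      -- choice below total in `j`.
      · refine ⟨∅, by simp, ?_, by simp⟩
        have : filtration s w j ≤ ⊥ := hbot ▸ filtration_antitone h
        exact this.trans bot_le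
    obtain ⟨b, hb, h1, h2, h3⟩ := exists_independent j A hA hgen
    exact ⟨b, hb, fun i => hap _ (h1 i), h2, h3⟩
  choose b hb hap hind hq using happ'
  have htame : ∀ I : Finset ℕ, Tame fun r => ∏ j ∈ I, ∏ i, F.fn (b j i) r := fun I =>
    Tame.prod I fun j _ => Tame.prod _ fun i _ => tame_fn hF (b j i)
  have hsplit : ∀ j, j < J → (fun r => ∏ j ∈ Finset.Ico j J, ∏ i, F.fn (b j i) r) =
      fun r => (∏ i, F.fn (b j i) r) * ∏ j ∈ Finset.Ico (j + 1) J, ∏ i, F.fn (b j i) r :=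
    fun j hj => funext fun r => Finset.prod_eq_prod_Ico_succ_bot hj _
  have hvol : ∀ t j, j + t = J → VolumeLE s F {c | w.level j ≤ w.weight c}
      fun r => ∏ j ∈ Finset.Ico j J, ∏ i, F.fn (b j i) r := by
    intro t
    induction t with
    | zero =>
      rintro j rfl
      simp only [Finset.Ico_self, Finset.prod_empty]
      exact volumeLE_of_trivial s F fun c hc => eval_eq_one (w := w) hc
    | succ t ih =>
      intro j hj
      rw [hsplit j (by omega)]
      exact volumeLE_step hwF j (b j) (hb j) (hq j) (fun r hr => ((htame _).pos r hr).le)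
        (ih (j + 1) (by omega))
  have hmany : ∀ t j, j + t = J → ManyShort s w F Γ j
      fun r => ∏ j ∈ Finset.Ico j J, ∏ i, F.fn (b j i) r := by
    intro t
    induction t with
    | zero =>
      rintro j rfl
      simp only [Finset.Ico_self, Finset.prod_empty]
      exact manyShort_one _
    | succ t ih =>
      intro j hj
      rw [hsplit j (by omega)]
      exact manyShort_step (hb j) (hind j) (hap j) (ih (j + 1) (by omega))
  have huniv : {c | w.level 0 ≤ w.weight c} = Set.univ :=
    Set.eq_univ_of_forall fun c => (isLeast_level_zero w).2 ⟨c, rfl⟩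
  set Ψ : ℝ → ℝ := fun r => ∏ j ∈ Finset.Ico 0 J, ∏ i, F.fn (b j i) r with hΨ
  have hΨt : Tame Ψ := htame _
  have hV := hvol J 0 (zero_add J)
  rw [huniv] at hV
  obtain ⟨K, hK0, hM⟩ := hmany J 0 (zero_add J)
  obtain ⟨l, hl, hlball⟩ := ball_subset_wordBall hF c₀ hΓ
  obtain ⟨m, hm, hmball⟩ := wordBall_subset_ball (s := s) (Γ := Γ) hF c₀ K
  let T := (finite_weight_le w (w.level J)).toFinset
  have hT : ∀ c ∉ T, c.eval s = 1 := by
    intro c hc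
    have : ¬ w.weight c ≤ w.level J := by simpa [T] using hc
    exact eval_eq_one (w := w) (not_le.mp this).le
  obtain ⟨C, hC⟩ := hV T.card
  have hsub : ∀ r : ℝ, 1 ≤ r → ball s F Γ c₀ r ⊆ costBall s F Set.univ T.card (l * r) :=
    fun r hr => (hlball r hr).trans
      (wordBall_subset_costBall T hT (one_le_mul_of_one_le_of_one_le hl hr))
  have hfin : ∀ r : ℝ, 1 ≤ r → (ball s F Γ c₀ r).Finite := fun r hr =>
    (hC (l * r) (one_le_mul_of_one_le_of_one_le hl hr)).1.subset (hsub r hr)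
  refine ⟨hfin, ComparableFrom.trans (g := Ψ) ?_ ?_⟩
  · obtain ⟨D, hD1, hD⟩ := hΨt.dilation l hl
    obtain ⟨E, hE1, hE⟩ := hΨt.dilation m hm
    have hone : ∀ r : ℝ, 1 ≤ r → (1 : ℝ) ≤ (ball s F Γ c₀ r).ncard := fun r hr => by
      have := (Set.ncard_pos (hfin r hr)).mpr ⟨1, one_mem_ball c₀ hr⟩
      exact_mod_cast this
    have hlow : ∀ r : ℝ, 1 ≤ r → Ψ r ≤ (ball s F Γ c₀ (m * r)).ncard := by
      intro r hr
      obtain ⟨Y, hY, hcard⟩ := hM r hr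
      have hYsub : (Y : Set G) ⊆ ball s F Γ c₀ (m * r) := fun y hy => hmball r hr (hY y hy).2
      have := Set.ncard_le_ncard hYsub (hfin _ (one_le_mul_of_one_le_of_one_le hm hr))
      rw [Set.ncard_coe_finset] at this
      exact hcard.trans (by exact_mod_cast this)
    have hm0 : 0 < m := by linarith
    have hΨm : 0 < Ψ m := hΨt.pos m hm
    -- `|C| * D` serves the upper bound, `E` the lower bound for `r ≥ m` (through the scale `r /
    -- m`), and `Ψ m` the lower bound for `r ≤ m`, where it suffices that the ball contains `1`.
    refine ⟨|C| * D + E + Ψ m, by have := abs_nonneg C; nlinarith, fun r hr => ⟨?_, ?_⟩⟩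
    · have hn0 : (0 : ℝ) ≤ (ball s F Γ c₀ r).ncard := Nat.cast_nonneg _
      rw [inv_mul_le_iff₀ (by positivity)]
      have hCD : 0 ≤ |C| * D := by positivity
      rcases le_total m r with h | h
      · have hrm : 1 ≤ r / m := (one_le_div hm0).mpr h
        have h1 := hE (r / m) hrm
        have h2 := hlow (r / m) hrm
        rw [mul_div_cancel₀ r hm0.ne'] at h1 h2
        refine (h1.trans (mul_le_mul_of_nonneg_left h2 (by linarith))).trans
          (mul_le_mul_of_nonneg_right ?_ hn0)
        linarith
      · refine (hΨt.mono hr hm h).trans ?_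
        refine (le_mul_of_one_le_right hΨm.le (hone r hr)).trans
          (mul_le_mul_of_nonneg_right ?_ hn0)
        linarith
    · have hlr := one_le_mul_of_one_le_of_one_le hl hr
      have h1 : ((ball s F Γ c₀ r).ncard : ℝ) ≤
          (costBall s F Set.univ (T.card : ℝ) (l * r)).ncard := by
        exact_mod_cast Set.ncard_le_ncard (hsub r hr) (hC _ hlr).1
      have h2 := (hC (l * r) hlr).2
      have hΨr := (hΨt.pos r hr).le
      calc ((ball s F Γ c₀ r).ncard : ℝ) ≤ C * Ψ (l * r) := h1.trans h2
        _ ≤ |C| * Ψ (l * r) :=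
          mul_le_mul_of_nonneg_right (le_abs_self C) (hΨt.pos _ hlr).le
        _ ≤ |C| * (D * Ψ r) := mul_le_mul_of_nonneg_left (hD r hr) (abs_nonneg C)
        _ = |C| * D * Ψ r := by ring
        _ ≤ (|C| * D + E + Ψ m) * Ψ r := mul_le_mul_of_nonneg_right (by linarith) hΨr
  · rw [hΨ, Finset.range_eq_Ico]
    refine ComparableFrom.prod _ (fun j _ r hr => pow_nonneg (F.fn_pos _ hr).le _) fun j _ => ?_
    have := ComparableFrom.prod Finset.univ (f := fun i => F.fn (b j i)) (g := fun _ => F.fn (e j))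
      (fun _ _ r hr => (F.fn_pos _ hr).le)
      fun i _ => hwF.comparable ((hb j i).trans (he j).symm)
    simpa using this

theorem ball_volume_univ (hs : Subgroup.closure (Set.range s) = ⊤) (hF : F.Doubling)
    (hwF : Compatible w F) (c₀ : FormalComm k) (e : ℕ → FormalComm k)
    (he : ∀ j, w.weight (e j) = w.level j) :
    (∀ r : ℝ, 1 ≤ r → (ball s F Set.univ c₀ r).Finite) ∧
      ComparableFrom 1 (fun r => ((ball s F Set.univ c₀ r).ncard : ℝ))
        fun r => ∏ j ∈ Finset.range (numSteps s w), F.fn (e j) r ^ gradedRank s w j := by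
  refine ball_volume hF hwF _ c₀ ?_ (fun j _ => ⟨_, fun _ hc => hc, filtration_le_sup j,
    fun c _ => approximable_of_mem w (Set.mem_univ c)⟩) e he
  rw [eq_top_iff, ← hs, ← closure_eval_letters]
  exact Subgroup.closure_mono (Set.image_mono (Set.subset_univ _))

theorem ball_volume_letters (hs : Subgroup.closure (Set.range s) = ⊤) (hF : F.Doubling)
    (hwF : Compatible w F) (c₀ : FormalComm k) (e : ℕ → FormalComm k)
    (he : ∀ j, w.weight (e j) = w.level j) :
    (∀ r : ℝ, 1 ≤ r → (ball s F (letters k) c₀ r).Finite) ∧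
      ComparableFrom 1 (fun r => ((ball s F (letters k) c₀ r).ncard : ℝ))
        fun r => ∏ j ∈ Finset.range (numSteps s w), F.fn (e j) r ^ gradedRank s w j :=
  ball_volume hF hwF _ c₀ (closure_eval_letters.trans hs) (fun j _ => ⟨_, fun _ hc => hc,
    filtration_le_sup j, fun c _ => approximable_letters w hs hF c⟩) e he

/-- The entries of each weight approximate themselves and generate their layer; climbing from the
trivial term shows that all entries together generate the group. -/
theorem ball_volume_adapted (hs : Subgroup.closure (Set.range s) = ⊤) (hF : F.Doubling)
    (hwF : Compatible w F) {t : ℕ} {c : Fin t → FormalComm k} (hc : IsAdapted s w c)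
    (c₀ : FormalComm k) (e : ℕ → FormalComm k) (he : ∀ j, w.weight (e j) = w.level j) :
    (∀ r : ℝ, 1 ≤ r → (ball s F (Set.range c) c₀ r).Finite) ∧
      ComparableFrom 1 (fun r => ((ball s F (Set.range c) c₀ r).ncard : ℝ))
        fun r => ∏ j ∈ Finset.range (numSteps s w), F.fn (e j) r ^ gradedRank s w j := by
  have hgen : ∀ j < numSteps s w, filtration s w j ≤
      Subgroup.closure (FormalComm.eval s '' (c '' {i | w.weight (c i) = w.level j})) ⊔
        filtration s w (j + 1) := by
    intro j hj
    rw [Set.image_image]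
    exact (hc.generates j hj).ge
  refine ball_volume hF hwF _ c₀ ?_ (fun j hj =>
    ⟨c '' {i | w.weight (c i) = w.level j}, ?_, hgen j hj, ?_⟩) e he
  · have h : ∀ t j, j + t = numSteps s w →
        filtration s w j ≤ Subgroup.closure (FormalComm.eval s '' Set.range c) := by
      intro t
      induction t with
      | zero =>
        intro j hj
        rw [add_zero] at hj
        rw [hj, filtration_numSteps]
        exact bot_le
      | succ t ih =>
        intro j hj
        refine (hgen j (by omega)).trans (sup_le ?_ (ih (j + 1) (by omega)))
        exact Subgroup.closure_mono (Set.image_mono (Set.image_subset_range _ _))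
    rw [eq_top_iff, ← filtration_zero (w := w) hs]
    exact h _ 0 (zero_add _)
  · rintro _ ⟨i, hi, rfl⟩
    exact hi
  · rintro _ ⟨i, -, rfl⟩
    exact approximable_of_mem w ⟨i, rfl⟩

end Volume

/-! ### Power weight functions. -/

section Power

variable {k : ℕ} (p : Fin k → ℝ) (hp : ∀ i, 0 < p i)

theorem powerFunctions_fn (c : FormalComm k) {r : ℝ} (hr : 1 ≤ r) :
    (powerFunctions p hp).fn c r = r ^ ofLex ((powerWeights p hp).weight c) 0 := by
  induction c with
  | letter i b => rfl
  | bracket a b ha hb =>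
    have h : ofLex ((powerWeights p hp).weight (.bracket a b)) 0 =
        ofLex ((powerWeights p hp).weight a) 0 + ofLex ((powerWeights p hp).weight b) 0 := rfl
    rw [h, Real.rpow_add (by linarith), ← ha, ← hb]
    rfl

theorem powerFunctions_doubling : (powerFunctions p hp).Doubling := by
  have h1 : ∀ i, (0 : ℝ) ≤ 2 ^ (p i)⁻¹ := fun i => by positivity
  have h2 : ∀ i, (0 : ℝ) ≤ 2 ^ p i := fun i => by positivity
  have h1s := fun i => Finset.single_le_sum (f := fun i => (2 : ℝ) ^ (p i)⁻¹)
    (fun i _ => h1 i) (Finset.mem_univ i)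
  have h2s := fun i => Finset.single_le_sum (f := fun i => (2 : ℝ) ^ p i)
    (fun i _ => h2 i) (Finset.mem_univ i)
  have h1t := Finset.sum_nonneg (s := Finset.univ) fun i _ => h1 i
  have h2t := Finset.sum_nonneg (s := Finset.univ) fun i _ => h2 i
  -- The two conditions ask for `C ≥ 2 ^ (1 / p i)` and `C ≥ 2 ^ p i`; sums replace maxima, and the
  -- `1` also covers `k = 0`.
  refine ⟨1 + (∑ i, (2 : ℝ) ^ (p i)⁻¹) + ∑ i, (2 : ℝ) ^ p i, by linarith, fun i r hr => ⟨?_, ?_⟩⟩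
  · change 2 * r ^ p i ≤ (_ * r) ^ p i
    rw [Real.mul_rpow (by linarith) (by linarith)]
    refine mul_le_mul_of_nonneg_right ?_ (by positivity)
    calc (2 : ℝ) = (2 ^ (p i)⁻¹) ^ p i := by
          rw [← Real.rpow_mul (by norm_num), inv_mul_cancel₀ (hp i).ne', Real.rpow_one]
      _ ≤ _ := Real.rpow_le_rpow (h1 i) (by linarith [h1s i]) (hp i).le
  · change (2 * r) ^ p i ≤ _ * r ^ p i
    rw [Real.mul_rpow (by norm_num) (by linarith)]
    exact mul_le_mul_of_nonneg_right (by linarith [h2s i]) (by positivity)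

theorem lex_fin_one_le_iff {u v : Lex (Fin (0 + 1) → ℝ)} : u ≤ v ↔ ofLex u 0 ≤ ofLex v 0 := by
  refine ⟨lex_coord_le, fun h => ?_⟩
  by_contra hlt
  obtain ⟨i, -, hi⟩ := not_le.mp hlt
  obtain rfl : i = 0 := Subsingleton.elim (α := Fin 1) _ _
  exact absurd h (not_le.mpr hi)

theorem powerFunctions_compatible : Compatible (powerWeights p hp) (powerFunctions p hp) := by
  intro c c'
  rw [lex_fin_one_le_iff]
  constructor
  · intro h
    refine ⟨1, le_rfl, fun r hr => ?_⟩
    rw [powerFunctions_fn p hp c hr, powerFunctions_fn p hp c' hr, one_mul]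
    exact Real.rpow_le_rpow_of_exponent_le hr h
  · rintro ⟨C, -, hC⟩
    by_contra! hlt
    obtain ⟨r, hrC, hr⟩ := ((tendsto_rpow_atTop (sub_pos.mpr hlt)).eventually_gt_atTop C |>.and
      (Filter.eventually_ge_atTop 1)).exists
    have h := hC r hr
    have hr0 : 0 < r := by linarith
    rw [powerFunctions_fn p hp c hr, powerFunctions_fn p hp c' hr,
      ← div_le_iff₀ (Real.rpow_pos_of_pos hr0 _), ← Real.rpow_sub hr0] at h
    linarith

theorem prod_powerFunctions {G : Type*} [Group G] (s : Fin k → G) (e : ℕ → FormalComm k)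
    (he : ∀ j, (powerWeights p hp).weight (e j) = (powerWeights p hp).level j) {r : ℝ}
    (hr : 1 ≤ r) :
    ∏ j ∈ Finset.range (numSteps s (powerWeights p hp)),
      (powerFunctions p hp).fn (e j) r ^ gradedRank s (powerWeights p hp) j =
      r ^ homDim s (powerWeights p hp) := by
  have hr0 : 0 < r := by linarith
  rw [homDim, Real.rpow_sum_of_pos hr0]
  refine Finset.prod_congr rfl fun j _ => ?_
  rw [powerFunctions_fn p hp _ hr, he, Real.rpow_mul_natCast hr0.le]

end Power

/-- The enumeration of the weights is meaningful only for `k ≠ 0`; the minimal commutator `c₀`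
attached to a ball supplies this. -/
theorem neZero_of_formalComm {k : ℕ} (c : FormalComm k) : NeZero k := by
  induction c with
  | letter i b => exact ⟨fun h => (h ▸ i).elim0⟩
  | bracket a b ha hb => exact ha

end WeightedVolume

theorem mainTheorem10 {G : Type*} [Group G] [Group.IsNilpotent G] {k : ℕ} (s : Fin k → G)
    (hs : Subgroup.closure (Set.range s) = ⊤) :
    -- general weight systems and weight-function systems
    (∀ (d : ℕ) (w : WeightSystem k d) (F : WeightFunctions k), F.Doubling → Compatible w F →
      ∀ (t : ℕ) (c : Fin t → FormalComm k), IsAdapted s w c →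
      ∀ cCom cSig cGen : FormalComm k, IsMinWeight w Set.univ cCom →
        IsMinWeight w (Set.range c) cSig → IsMinWeight w (letters k) cGen →
      ∀ (r₀ : ℝ) (bF : ℕ → ℝ → ℝ), 1 ≤ r₀ →
        (∀ j < numSteps s w, ∀ c' : FormalComm k, w.weight c' = w.level j →
          ComparableFrom r₀ (bF j) (F.fn c')) →
      (∀ r : ℝ, 1 ≤ r → (ball s F Set.univ cCom r).Finite ∧
        (ball s F (Set.range c) cSig r).Finite ∧ (ball s F (letters k) cGen r).Finite) ∧
      ComparableFrom 1 (fun r => ((ball s F Set.univ cCom r).ncard : ℝ))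
        (fun r => ((ball s F (Set.range c) cSig r).ncard : ℝ)) ∧
      ComparableFrom 1 (fun r => ((ball s F (Set.range c) cSig r).ncard : ℝ))
        (fun r => ((ball s F (letters k) cGen r).ncard : ℝ)) ∧
      ComparableFrom r₀ (fun r => ((ball s F (letters k) cGen r).ncard : ℝ))
        (fun r => ∏ j ∈ Finset.range (numSteps s w), bF j r ^ gradedRank s w j)) ∧
    -- power weights
    (∀ (p : Fin k → ℝ) (hp : ∀ i, 0 < p i),
      (∀ cCom : FormalComm k, IsMinWeight (powerWeights p hp) Set.univ cCom →
        ComparableFrom 1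
          (fun r => ((ball s (powerFunctions p hp) Set.univ cCom r).ncard : ℝ))
          (fun r => r ^ homDim s (powerWeights p hp))) ∧
      (∀ (t : ℕ) (c : Fin t → FormalComm k), IsAdapted s (powerWeights p hp) c →
        ∀ cSig : FormalComm k, IsMinWeight (powerWeights p hp) (Set.range c) cSig →
        ComparableFrom 1
          (fun r => ((ball s (powerFunctions p hp) (Set.range c) cSig r).ncard : ℝ))
          (fun r => r ^ homDim s (powerWeights p hp))) ∧
      (∀ cGen : FormalComm k, IsMinWeight (powerWeights p hp) (letters k) cGen →
        ComparableFrom 1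
          (fun r => ((ball s (powerFunctions p hp) (letters k) cGen r).ncard : ℝ))
          (fun r => r ^ homDim s (powerWeights p hp)))) := by
  refine ⟨?_, ?_⟩
  · intro d w F hF hwF t c hc cCom cSig cGen _ _ _ r₀ bF hr₀ hbF
    have := neZero_of_formalComm cCom
    choose e he using level_mem w
    obtain ⟨f1, h1⟩ := ball_volume_univ hs hF hwF cCom e he
    obtain ⟨f2, h2⟩ := ball_volume_adapted hs hF hwF hc cSig e he
    obtain ⟨f3, h3⟩ := ball_volume_letters hs hF hwF cGen e he
    refine ⟨fun r hr => ⟨f1 r hr, f2 r hr, f3 r hr⟩, h1.trans h2.symm, h2.trans h3.symm,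
      (h3.of_le hr₀).trans (ComparableFrom.symm ?_)⟩
    have hpos : ∀ j, ∀ r, r₀ ≤ r → 0 ≤ F.fn (e j) r := fun j r hr =>
      (F.fn_pos (e j) (hr₀.trans hr)).le
    exact ComparableFrom.prod _ (fun j _ r hr => pow_nonneg (hpos j r hr) _) fun j hj =>
      (hbF j (Finset.mem_range.mp hj) (e j) (he j)).pow (hpos j) _
  · intro p hp
    have hF := powerFunctions_doubling p hp
    have hwF := powerFunctions_compatible p hp
    have key : ∀ (e : ℕ → FormalComm k),
        (∀ j, (powerWeights p hp).weight (e j) = (powerWeights p hp).level j) →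
        ComparableFrom 1 (fun r => ∏ j ∈ Finset.range (numSteps s (powerWeights p hp)),
          (powerFunctions p hp).fn (e j) r ^ gradedRank s (powerWeights p hp) j)
          fun r => r ^ homDim s (powerWeights p hp) := fun e he =>
      ⟨1, le_rfl, fun r hr => by simp [prod_powerFunctions p hp s e he hr]⟩
    refine ⟨fun cCom _ => ?_, fun t c hc cSig _ => ?_, fun cGen _ => ?_⟩
    · have := neZero_of_formalComm cCom
      choose e he using level_mem (powerWeights p hp)
      exact (ball_volume_univ hs hF hwF cCom e he).2.trans (key e he)
    · have := neZero_of_formalComm cSig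
      choose e he using level_mem (powerWeights p hp)
      exact (ball_volume_adapted hs hF hwF hc cSig e he).2.trans (key e he)
    · have := neZero_of_formalComm cGen
      choose e he using level_mem (powerWeights p hp)
      exact (ball_volume_letters hs hF hwF cGen e he).2.trans (key e he)
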